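/- Let $k\ge 2$ and let $M$ be a compact $\mathbb Z/k$-manifold: a compact smooth manifold with (possibly empty) boundary together with a closed smooth manifold $\beta M$ and a diffeomorphism $\phi\colon \partial M\to \beta M\times \mathbb Z/k$, where $\mathbb Z/k$ is a discrete set of $k$ points. Let $p\colon\partial M\to\beta M$ be $\phi$ followed by the projection to the first factor, let $N=M\cup_{\partial M}(\partial M\times[0,\infty))$, where $x\in\partial M$ is identified with $(x,0)$, and let $\sim$ be the equivalence relation on $N$ for which points of $M$ are equivalent only to themselves, and $(x,t)\sim(y,s)$, for $x,y\in\partial M$ and $t,s>0$, if and only if $t=s$ and $p(x)=p(y)$. Let $G=\{(a,b)\in N\times N : a\sim b\}$, with the relative topology, be the corresponding groupoid; it is locally compact, Hausdorff and étale, and it is given the Haar system of counting measures. Let $\mathbb F$ be $\mathbb R$ or $\mathbb C$. On the $*$-algebra $C_c(G)$ of continuous compactly supported functions $G\to\mathbb F$, with convolution $(f*g)(a,c)=\sum_{b\sim a}f(a,b)g(b,c)$ and involution $f^*(a,b)=\overline{f(b,a)}$, let $$\|f\|_I=\max\Bigl(\sup_a\sum_{b\sim a}|f(a,b)|,\ \sup_b\sum_{a\sim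 b}|f(a,b)|\Bigr),$$ and let $C^*(M;\mathbb Z/k)=C^*(G)$ be the (full) groupoid $C^*$-algebra over $\mathbb F$, i.e. the completion of $C_c(G)$ in the norm $\|f\|=\sup_\pi\|\pi(f)\|$, where $\pi$ runs over the $*$-representations of $C_c(G)$ on Hilbert spaces over $\mathbb F$ with $\|\pi(f)\|\le\|f\|_I$ for all $f$. Then, both for $\mathbb F=\mathbb R$ and for $\mathbb F=\mathbb C$, there is a short exact sequence of $C^*$-algebras over $\mathbb F$ $$0\to C_0(\mathbb R)\otimes C(\beta M)\otimes M_k(\mathbb F)\to C^*(M;\mathbb Z/k)\to C(M)\to 0,$$ in which all function algebras have values in $\mathbb F$, and the map to $C(M)$ is given on $f\in C_c(G)$ by restriction to the units in $M$, $x\mapsto f(x,x)$. Here the $C^*$-tensor product $C_0(\mathbb R)\otimes C(\beta M)\otimes M_k(\mathbb F)$ is the completion of the algebraic tensor product in its unique $C^*$-norm, $\bigl\|\sum_j f_j\otimes g_j\otimes a_j\bigr\|=\sup_{t\in\mathbb R,\,b\in\beta M}\bigl\|\sum_j f_j(t)g_j(b)a_j\bigr\|$. -/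

import Mathlib

open scoped Manifold ContDiff

noncomputable section

open Set Filter Topology
open scoped NNReal ENNReal ZeroAtInfty TensorProduct CompactlySupported

set_option linter.unusedSectionVars false

universe u v

namespace EquivRel

variable {X : Type u} [TopologicalSpace X]

/-- An equivalence relation `s` on `X`, viewed as a topological groupoid: the arrows are the pairs
`(x, y)` with `x ∼ y`, with range `x`, source `y`, product `(x, y) (y, z) = (x, z)`, inverse `(y, x)`
and the relative topology from `X × X`. -/
abbrev Graph (s : Setoid X) : Type u := {p : X × X // s p.1 p.2}

/-- The groupoid of `s` is étale (`r`-discrete with a Haar system): the range map is a local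
homeomorphism. The counting measures on the fibres of `r` are then a Haar system. -/
class IsEtale (s : Setoid X) : Prop where
  isLocalHomeomorph : IsLocalHomeomorph (fun g : Graph s => g.1.1)

variable {s : Setoid X}

theorem exists_ne_zero_of_finsum {ι A : Type*} [AddCommMonoid A] {F : ι → A}
    (h : ∑ᶠ i, F i ≠ 0) : ∃ i, F i ≠ 0 := by
  by_contra! h'
  exact h (finsum_eq_zero_of_forall_eq_zero h')

theorem finite_fiber [T2Space X] [hs : IsEtale s] {K : Set (Graph s)} (hK : IsCompact K) (x : X) :
    {g : Graph s | g ∈ K ∧ g.1.1 = x}.Finite := by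
  have hcl : IsClosed {g : Graph s | g.1.1 = x} :=
    isClosed_singleton.preimage (hs.isLocalHomeomorph.continuous)
  have hc : IsCompact {g : Graph s | g ∈ K ∧ g.1.1 = x} := hK.inter_right hcl
  refine hc.finite ?_
  have := hs.isLocalHomeomorph.isLocalHomeomorphOn.mono
    (subset_univ {g : Graph s | g ∈ K ∧ g.1.1 = x})
  refine this.isDiscrete_of_image ?_
  refine Set.Subsingleton.isDiscrete ?_
  rintro _ ⟨a, ha, rfl⟩ _ ⟨b, hb, rfl⟩
  exact ha.2.trans hb.2.symm

theorem exists_sections [T2Space X] [hs : IsEtale s] {K : Set (Graph s)} (hK : IsCompact K)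
    (x₀ : X) : ∃ (T : Finset (Graph s)) (σ : Graph s → X → Graph s),
      (∀ a ∈ T, a.1.1 = x₀ ∧ σ a x₀ = a ∧ ContinuousAt (σ a) x₀) ∧
      ∀ᶠ x in 𝓝 x₀, (∀ a ∈ T, (σ a x).1.1 = x) ∧ InjOn (fun a => σ a x) T ∧
        ∀ b ∈ K, b.1.1 = x → ∃ a ∈ T, σ a x = b := by
  classical
  have hr := hs.isLocalHomeomorph
  refine ⟨(finite_fiber hK x₀).toFinset, fun a => hr.localInverseAt a, ?_, ?_⟩
  · intro a ha
    obtain ⟨-, rfl⟩ : a ∈ K ∧ a.1.1 = x₀ := by simpa using ha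
    exact ⟨rfl, hr.localInverseAt_apply_self,
      (hr.localInverseAt a).continuousAt hr.apply_self_mem_localInverseAt_source⟩
  · have hT : ∀ a ∈ (finite_fiber hK x₀).toFinset, a ∈ K ∧ a.1.1 = x₀ := fun a ha => by
      simpa using ha
    have h1 : ∀ a ∈ (finite_fiber hK x₀).toFinset,
        ∀ᶠ x in 𝓝 x₀, (hr.localInverseAt a x).1.1 = x := by
      intro a ha
      obtain ⟨-, rfl⟩ := hT a ha
      filter_upwards [(hr.localInverseAt a).open_source.mem_nhds
        hr.apply_self_mem_localInverseAt_source] with x hx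
      exact hr.apply_localInverseAt_of_mem hx
    have h2 : ∀ a ∈ (finite_fiber hK x₀).toFinset, ∀ b ∈ (finite_fiber hK x₀).toFinset,
        ∀ᶠ x in 𝓝 x₀, a ≠ b → hr.localInverseAt a x ≠ hr.localInverseAt b x := by
      intro a ha b hb
      by_cases hab : a = b
      · simp [hab]
      have ca : ContinuousAt (hr.localInverseAt a) x₀ := by
        obtain ⟨-, rfl⟩ := hT a ha
        exact (hr.localInverseAt a).continuousAt hr.apply_self_mem_localInverseAt_source
      have cb : ContinuousAt (hr.localInverseAt b) x₀ := by
        obtain ⟨-, rfl⟩ := hT b hb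
        exact (hr.localInverseAt b).continuousAt hr.apply_self_mem_localInverseAt_source
      have ea : hr.localInverseAt a x₀ = a := by
        obtain ⟨-, rfl⟩ := hT a ha
        exact hr.localInverseAt_apply_self
      have eb : hr.localInverseAt b x₀ = b := by
        obtain ⟨-, rfl⟩ := hT b hb
        exact hr.localInverseAt_apply_self
      have := (ca.ne_iff_eventually_ne cb).1 (by rw [ea, eb]; exact hab)
      filter_upwards [this] with x hx _ using hx
    have h3 : ∀ᶠ x in 𝓝 x₀, ∀ b ∈ K, b.1.1 = x →
        ∃ a ∈ (finite_fiber hK x₀).toFinset, hr.localInverseAt a x = b := by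
      set U : Set (Graph s) := ⋃ a ∈ (finite_fiber hK x₀).toFinset, (hr.localInverseAt a).target
        with hU
      have hUo : IsOpen U := isOpen_biUnion fun a _ => (hr.localInverseAt a).open_target
      have hK' : IsCompact ((fun g : Graph s => g.1.1) '' (K \ U)) :=
        (hK.diff hUo).image hr.continuous
      have hx : x₀ ∉ (fun g : Graph s => g.1.1) '' (K \ U) := by
        rintro ⟨a, ⟨haK, haU⟩, hax⟩
        apply haU
        rw [hU]
        exact mem_biUnion (x := a) (by simpa using ⟨haK, hax⟩)
          hr.self_mem_localInverseAt_target
      filter_upwards [hK'.isClosed.isOpen_compl.mem_nhds hx] with x hx b hb hbx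
      have hbU : b ∈ U := by
        by_contra hbU
        exact hx ⟨b, ⟨hb, hbU⟩, hbx⟩
      rw [hU] at hbU
      obtain ⟨a, ha, hab⟩ := mem_iUnion₂.1 hbU
      refine ⟨a, ha, ?_⟩
      rw [← hbx]
      have h := (hr.localInverseAt a).right_inv hab
      rwa [hr.localInverseAt_symm] at h
    filter_upwards [(Filter.eventually_all_finset _).2 h1,
      (Filter.eventually_all_finset _).2 fun a ha => (Filter.eventually_all_finset _).2 (h2 a ha),
      h3] with x e1 e2 e3
    refine ⟨e1, fun a ha b hb hab => ?_, e3⟩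
    by_contra hne
    exact e2 a ha b hb hne hab

theorem finsum_eq_sum_sections {A : Type*} [AddCommMonoid A] {K : Set (Graph s)} {x : X}
    {T : Finset (Graph s)} {τ : Graph s → Graph s} (h1 : ∀ a ∈ T, (τ a).1.1 = x)
    (h2 : InjOn τ T) (h3 : ∀ b ∈ K, b.1.1 = x → ∃ a ∈ T, τ a = b) (F : X → A)
    (hF : ∀ y, F y ≠ 0 → ∃ b ∈ K, b.1 = (x, y)) :
    ∑ᶠ y, F y = ∑ a ∈ T, F (τ a).1.2 := by
  classical
  rw [finsum_eq_sum_of_support_subset (s := T.image fun a => (τ a).1.2) F]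
  · rw [Finset.sum_image]
    intro a ha b hb hab
    exact h2 ha hb (Subtype.ext (Prod.ext ((h1 a ha).trans (h1 b hb).symm) hab))
  · intro y hy
    obtain ⟨b, hb, hbx⟩ := hF y hy
    obtain ⟨a, ha, rfl⟩ := h3 b hb (by rw [hbx])
    simp only [Finset.coe_image, mem_image]
    exact ⟨a, ha, by rw [hbx]⟩

/-- The convolution algebra `C_c(G)` of the groupoid `G` of `s`, with scalars `𝕜 = ℝ` or `ℂ`. As a
vector space it consists of the continuous functions `G → 𝕜` with compact support. -/
def ConvAlg (𝕜 : Type) [RCLike 𝕜] (s : Setoid X) : Type u := C_c(Graph s, 𝕜)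

namespace ConvAlg

variable {𝕜 : Type} [RCLike 𝕜] {s : Setoid X}

instance : AddCommGroup (ConvAlg 𝕜 s) := inferInstanceAs (AddCommGroup C_c(Graph s, 𝕜))

instance : Module 𝕜 (ConvAlg 𝕜 s) := inferInstanceAs (Module 𝕜 C_c(Graph s, 𝕜))

/-- The compactly supported function underlying an element of the convolution algebra. -/
def toCc (f : ConvAlg 𝕜 s) : C_c(Graph s, 𝕜) := f

open Classical in
/-- The value `f(x, y)`, extended by `0` to all pairs `(x, y)`. -/
def coef (f : ConvAlg 𝕜 s) (x y : X) : 𝕜 := if h : s x y then f.toCc ⟨(x, y), h⟩ else 0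

theorem coef_graph (f : ConvAlg 𝕜 s) (g : Graph s) : f.coef g.1.1 g.1.2 = f.toCc g := by
  simp [coef, g.2]

theorem coef_of_not (f : ConvAlg 𝕜 s) {x y : X} (h : ¬ s x y) : f.coef x y = 0 := by
  simp [coef, h]

theorem ext {f g : ConvAlg 𝕜 s} (h : ∀ x y, f.coef x y = g.coef x y) : f = g := by
  refine DFunLike.ext (F := C_c(Graph s, 𝕜)) _ _ fun p => ?_
  have := h p.1.1 p.1.2
  rwa [coef_graph, coef_graph] at this

theorem coef_add (f g : ConvAlg 𝕜 s) (x y : X) : (f + g).coef x y = f.coef x y + g.coef x y := by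
  by_cases h : s x y
  · simp only [coef, h, dif_pos]; rfl
  · simp [coef, h]

theorem coef_smul (c : 𝕜) (f : ConvAlg 𝕜 s) (x y : X) : (c • f).coef x y = c * f.coef x y := by
  by_cases h : s x y
  · simp only [coef, h, dif_pos]; rfl
  · simp [coef, h]

theorem coef_zero (x y : X) : (0 : ConvAlg 𝕜 s).coef x y = 0 := by
  by_cases h : s x y
  · simp only [coef, h, dif_pos]; rfl
  · simp [coef, h]

theorem continuousOn_coef (f : ConvAlg 𝕜 s) :
    ContinuousOn (fun p : X × X => f.coef p.1 p.2) {p | s p.1 p.2} := by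
  rw [continuousOn_iff_continuous_domRestrict]
  refine (map_continuous f.toCc).congr fun g => ?_
  exact (coef_graph f g).symm

theorem exists_mem_of_coef_ne_zero (f : ConvAlg 𝕜 s) {x y : X} (h : f.coef x y ≠ 0) :
    ∃ b ∈ tsupport f.toCc, b.1 = (x, y) := by
  by_cases hs : s x y
  · refine ⟨⟨(x, y), hs⟩, subset_tsupport _ ?_, rfl⟩
    have := coef_graph f ⟨(x, y), hs⟩
    rw [Function.mem_support, ← this]
    exact h
  · exact absurd (coef_of_not f hs) h

/-- Inversion `(x, y) ↦ (y, x)` of the groupoid. -/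
def flip : Graph s ≃ₜ Graph s where
  toFun p := ⟨(p.1.2, p.1.1), s.symm' p.2⟩
  invFun p := ⟨(p.1.2, p.1.1), s.symm' p.2⟩
  left_inv _ := rfl
  right_inv _ := rfl
  continuous_toFun := by fun_prop
  continuous_invFun := by fun_prop

theorem flip_apply (p : Graph s) : flip p = ⟨(p.1.2, p.1.1), s.symm' p.2⟩ := rfl

/-- The involution `f⋆(x, y) = conj (f(y, x))`. -/
instance : Star (ConvAlg 𝕜 s) where
  star f := (⟨⟨fun p => star (f.toCc (flip p)),
      (map_continuous f.toCc).star.comp flip.continuous⟩,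
    (f.toCc.hasCompactSupport.comp_homeomorph flip).comp_left (star_zero 𝕜)⟩ : C_c(Graph s, 𝕜))

theorem coef_star (f : ConvAlg 𝕜 s) (x y : X) : (star f).coef x y = star (f.coef y x) := by
  by_cases h : s x y
  · have h' := s.symm' h
    rw [show (star f).coef x y = _ from coef_graph (star f) ⟨(x, y), h⟩,
      show f.coef y x = _ from coef_graph f ⟨(y, x), h'⟩]
    rfl
  · rw [coef_of_not _ h, coef_of_not _ fun h' => h (s.symm' h'), star_zero]

instance : StarModule 𝕜 (ConvAlg 𝕜 s) where
  star_smul c f := ext fun x y => by simp [coef_star, coef_smul]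

/-- The `I`-norm of `f`: the larger of `sup_x ∑_{r(γ) = x} |f(γ)|` and `sup_y ∑_{s(γ) = y} |f(γ)|`. -/
def iNorm (f : ConvAlg 𝕜 s) : ℝ :=
  max (⨆ x, ∑ᶠ y, ‖f.coef x y‖) (⨆ y, ∑ᶠ x, ‖f.coef x y‖)

variable [T2Space X] [IsEtale s]

theorem finite_coef (f : ConvAlg 𝕜 s) (x : X) : {y | f.coef x y ≠ 0}.Finite := by
  refine ((finite_fiber (f.toCc.hasCompactSupport) x).image fun g => g.1.2).subset ?_
  intro y hy
  obtain ⟨b, hb, hbx⟩ := f.exists_mem_of_coef_ne_zero hy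
  exact ⟨b, ⟨hb, by rw [hbx]⟩, by simp [hbx]⟩

theorem continuous_conv (f g : ConvAlg 𝕜 s) :
    Continuous fun p : Graph s => ∑ᶠ y, f.coef p.1.1 y * g.coef y p.1.2 := by
  rw [continuous_iff_continuousAt]
  intro p₀
  obtain ⟨T, σ, hT, hσ⟩ := exists_sections (f.toCc.hasCompactSupport) p₀.1.1
  have hr : ContinuousAt (fun p : Graph s => p.1.1) p₀ := by fun_prop
  have hev := hr.eventually hσ
  have key : ContinuousAt (fun p : Graph s => ∑ a ∈ T,
      f.coef p.1.1 (σ a p.1.1).1.2 * g.coef (σ a p.1.1).1.2 p.1.2) p₀ := by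
    refine tendsto_finsetSum _ fun a ha => ?_
    obtain ⟨h1, h2, h3⟩ := hT a ha
    have hca : ContinuousAt (fun p : Graph s => (σ a p.1.1).1.2) p₀ := by
      have : ContinuousAt (fun p : Graph s => σ a p.1.1) p₀ := ContinuousAt.comp h3 hr
      exact (continuous_snd.comp continuous_subtype_val).continuousAt.comp this
    refine Tendsto.mul ?_ ?_
    · refine (f.continuousOn_coef (p₀.1.1, (σ a p₀.1.1).1.2) ?_).tendsto.comp
        (tendsto_nhdsWithin_iff.2 ⟨hr.prodMk_nhds hca, ?_⟩)
      · have := (σ a p₀.1.1).2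
        rw [h2] at this ⊢
        rwa [h1] at this
      · filter_upwards [hev] with p hp
        have := (σ a p.1.1).2
        rwa [hp.1 a ha] at this
    · refine (g.continuousOn_coef ((σ a p₀.1.1).1.2, p₀.1.2) ?_).tendsto.comp
        (tendsto_nhdsWithin_iff.2 ⟨hca.prodMk_nhds
          (continuous_snd.comp continuous_subtype_val).continuousAt, ?_⟩)
      · have := (σ a p₀.1.1).2
        rw [h2] at this ⊢
        rw [h1] at this
        exact s.trans' (s.symm' this) p₀.2
      · filter_upwards [hev] with p hp
        have := (σ a p.1.1).2
        rw [hp.1 a ha] at this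
        exact s.trans' (s.symm' this) p.2
  refine key.congr ?_
  filter_upwards [hev] with p hp
  refine (finsum_eq_sum_sections hp.1 hp.2.1 hp.2.2 (fun y => f.coef p.1.1 y * g.coef y p.1.2)
    fun y hy => f.exists_mem_of_coef_ne_zero (left_ne_zero_of_mul hy)).symm

theorem hasCompactSupport_conv (f g : ConvAlg 𝕜 s) :
    HasCompactSupport fun p : Graph s => ∑ᶠ y, f.coef p.1.1 y * g.coef y p.1.2 := by
  have hE : IsClosed {q : Graph s × Graph s | q.1.1.2 = q.2.1.1} :=
    isClosed_eq (by fun_prop) (by fun_prop)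
  have hC : IsCompact ((fun q : Graph s × Graph s => (q.1.1.1, q.2.1.2)) ''
      ((tsupport f.toCc ×ˢ tsupport g.toCc) ∩ {q : Graph s × Graph s | q.1.1.2 = q.2.1.1})) :=
    (((f.toCc.hasCompactSupport).prod (g.toCc.hasCompactSupport)).inter_right hE).image
      (by fun_prop)
  have hC' := (IsInducing.subtypeVal (t := {p : X × X | s p.1 p.2})).isCompact_preimage_iff
    (K := (fun q : Graph s × Graph s => (q.1.1.1, q.2.1.2)) ''
      ((tsupport f.toCc ×ˢ tsupport g.toCc) ∩ {q : Graph s × Graph s | q.1.1.2 = q.2.1.1}))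
    (by
      rintro _ ⟨⟨a, b⟩, ⟨-, hab⟩, rfl⟩
      have hab' : a.1.2 = b.1.1 := hab
      have h1 := a.2
      rw [hab'] at h1
      exact ⟨⟨(a.1.1, b.1.2), s.trans' h1 b.2⟩, rfl⟩)
  refine HasCompactSupport.intro (hC'.2 hC) fun p hp => ?_
  by_contra hne
  obtain ⟨y, hy⟩ := exists_ne_zero_of_finsum hne
  obtain ⟨a, ha, hax⟩ := f.exists_mem_of_coef_ne_zero (left_ne_zero_of_mul hy)
  obtain ⟨b, hb, hbx⟩ := g.exists_mem_of_coef_ne_zero (right_ne_zero_of_mul hy)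
  refine hp ⟨(a, b), ⟨⟨ha, hb⟩, ?_⟩, ?_⟩
  · simp [hax, hbx]
  · simp [hax, hbx]

/-- Convolution `(f * g)(γ) = ∑_{αβ = γ} f(α) g(β)`, i.e. `(f * g)(x, z) = ∑_{y ∼ x} f(x, y) g(y, z)`. -/
instance : Mul (ConvAlg 𝕜 s) where
  mul f g := (⟨⟨fun p => ∑ᶠ y, f.coef p.1.1 y * g.coef y p.1.2, continuous_conv f g⟩,
    hasCompactSupport_conv f g⟩ : C_c(Graph s, 𝕜))

theorem coef_mul (f g : ConvAlg 𝕜 s) (x z : X) :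
    (f * g).coef x z = ∑ᶠ y, f.coef x y * g.coef y z := by
  by_cases h : s x z
  · exact coef_graph (f * g) ⟨(x, z), h⟩
  · rw [coef_of_not _ h, finsum_eq_zero_of_forall_eq_zero]
    intro y
    by_cases h1 : s x y
    · rw [g.coef_of_not fun h2 => h (s.trans' h1 h2), mul_zero]
    · rw [f.coef_of_not h1, zero_mul]

theorem finite_coef' (f : ConvAlg 𝕜 s) (y : X) : {x | f.coef x y ≠ 0}.Finite := by
  refine ((star f).finite_coef y).subset fun x hx => ?_
  simpa [coef_star] using hx

theorem mul_assoc' (f g h : ConvAlg 𝕜 s) : f * g * h = f * (g * h) := by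
  refine ext fun x z => ?_
  simp only [coef_mul]
  have e1 : ∀ w, (∑ᶠ y, f.coef x y * g.coef y w) * h.coef w z
      = ∑ᶠ y, f.coef x y * g.coef y w * h.coef w z := fun w => by
    rw [finsum_mul]
  have e2 : ∀ y, f.coef x y * (∑ᶠ w, g.coef y w * h.coef w z)
      = ∑ᶠ w, f.coef x y * g.coef y w * h.coef w z := fun y => by
    rw [mul_finsum]
    simp only [mul_assoc]
  simp only [e1, e2]
  set A := (f.finite_coef x).toFinset with hA
  set B := (h.finite_coef' z).toFinset with hB
  have a1 : ∀ w, ∑ᶠ y, f.coef x y * g.coef y w * h.coef w z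
      = ∑ y ∈ A, f.coef x y * g.coef y w * h.coef w z := fun w =>
    finsum_eq_sum_of_support_subset _ fun y hy => by
      simpa [hA] using left_ne_zero_of_mul (left_ne_zero_of_mul hy)
  have a2 : ∀ y, ∑ᶠ w, f.coef x y * g.coef y w * h.coef w z
      = ∑ w ∈ B, f.coef x y * g.coef y w * h.coef w z := fun w =>
    finsum_eq_sum_of_support_subset _ fun y hy => by
      simpa [hB] using right_ne_zero_of_mul hy
  simp only [a1, a2]
  rw [finsum_eq_sum_of_support_subset (s := B), finsum_eq_sum_of_support_subset (s := A),
    Finset.sum_comm]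
  · intro y hy
    obtain ⟨w, hw, hw'⟩ := Finset.exists_ne_zero_of_sum_ne_zero hy
    simpa [hA] using left_ne_zero_of_mul (left_ne_zero_of_mul hw')
  · intro w hw
    obtain ⟨y, hy, hy'⟩ := Finset.exists_ne_zero_of_sum_ne_zero hw
    simpa [hB] using right_ne_zero_of_mul hy'

theorem finite_term (f g : ConvAlg 𝕜 s) (x z : X) :
    (Function.support fun y => f.coef x y * g.coef y z).Finite :=
  (f.finite_coef x).subset fun _ hy => left_ne_zero_of_mul hy

instance : NonUnitalRing (ConvAlg 𝕜 s) where
  left_distrib f g h := ext fun x z => by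
    simp only [coef_mul, coef_add, mul_add]
    exact finsum_add_distrib (finite_term f g x z) (finite_term f h x z)
  right_distrib f g h := ext fun x z => by
    simp only [coef_mul, coef_add, add_mul]
    exact finsum_add_distrib (finite_term f h x z) (finite_term g h x z)
  zero_mul f := ext fun x z => by simp [coef_mul, coef_zero]
  mul_zero f := ext fun x z => by simp [coef_mul, coef_zero]
  mul_assoc := mul_assoc'

instance : StarRing (ConvAlg 𝕜 s) where
  star_involutive f := ext fun x y => by simp [coef_star]
  star_add f g := ext fun x y => by simp [coef_star, coef_add]
  star_mul f g := ext fun x z => by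
    simp only [coef_star, coef_mul]
    have h := AddMonoidHom.map_finsum (starAddEquiv (R := 𝕜)).toAddMonoidHom
      (finite_term f g z x)
    simp only [AddEquiv.coe_toAddMonoidHom, starAddEquiv_apply] at h
    rw [h]
    simp only [star_mul]

instance : IsScalarTower 𝕜 (ConvAlg 𝕜 s) (ConvAlg 𝕜 s) where
  smul_assoc c f g := ext fun x z => by
    simp only [smul_eq_mul, coef_smul, coef_mul, mul_assoc]
    rw [mul_finsum]

instance : SMulCommClass 𝕜 (ConvAlg 𝕜 s) (ConvAlg 𝕜 s) where
  smul_comm c f g := ext fun x z => by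
    simp only [smul_eq_mul, coef_smul, coef_mul]
    rw [mul_finsum]
    simp only [mul_left_comm]

theorem bddAbove_row (f : ConvAlg 𝕜 s) : BddAbove (range fun x => ∑ᶠ y, ‖f.coef x y‖) := by
  have hK := f.toCc.hasCompactSupport
  have hcont : Continuous fun x => ∑ᶠ y, ‖f.coef x y‖ := by
    rw [continuous_iff_continuousAt]
    intro x₀
    obtain ⟨T, σ, hT, hσ⟩ := exists_sections hK x₀
    have key : ContinuousAt (fun x => ∑ a ∈ T, ‖f.coef x (σ a x).1.2‖) x₀ := by
      refine tendsto_finsetSum _ fun a ha => ?_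
      obtain ⟨h1, h2, h3⟩ := hT a ha
      have h4 : ContinuousAt (fun x => ‖f.toCc (σ a x)‖) x₀ :=
        ((map_continuous f.toCc).norm.continuousAt).comp h3
      refine ContinuousAt.congr h4 ?_
      filter_upwards [hσ] with x hx
      rw [← coef_graph, hx.1 a ha]
    refine key.congr ?_
    filter_upwards [hσ] with x hx
    refine (finsum_eq_sum_sections hx.1 hx.2.1 hx.2.2 (fun y => ‖f.coef x y‖)
      fun y hy => f.exists_mem_of_coef_ne_zero (norm_ne_zero_iff.1 hy)).symm
  have hcs : HasCompactSupport fun x => ∑ᶠ y, ‖f.coef x y‖ := by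
    refine HasCompactSupport.intro (hK.isCompact.image
      (f := fun g : Graph s => g.1.1) (by fun_prop)) fun x hx => ?_
    by_contra hne
    obtain ⟨y, hy⟩ := exists_ne_zero_of_finsum hne
    obtain ⟨b, hb, hbx⟩ := f.exists_mem_of_coef_ne_zero (norm_ne_zero_iff.1 hy)
    exact hx ⟨b, hb, by simp [hbx]⟩
  exact hcont.bddAbove_range_of_hasCompactSupport hcs

theorem bddAbove_col (f : ConvAlg 𝕜 s) : BddAbove (range fun y => ∑ᶠ x, ‖f.coef x y‖) := by
  simpa [coef_star] using (star f).bddAbove_row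

end ConvAlg

variable (𝕜 : Type) [RCLike 𝕜] (s : Setoid X) [T2Space X] [IsEtale s]

/-- A bounded representation of `C_c(G)`: a `⋆`-homomorphism to the bounded operators on a Hilbert
space over `𝕜` with `‖π(f)‖ ≤ ‖f‖_I`. -/
structure Rep : Type (u + 1) where
  H : Type u
  [instNACG : NormedAddCommGroup H]
  [instIPS : InnerProductSpace 𝕜 H]
  [instComplete : CompleteSpace H]
  toHom : ConvAlg 𝕜 s →⋆ₙₐ[𝕜] (H →L[𝕜] H)
  norm_le : ∀ f, ‖toHom f‖ ≤ f.iNorm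

attribute [instance] Rep.instNACG Rep.instIPS Rep.instComplete

/-- The `ℓ^∞`-direct sum of the algebras `B(H_π)` over all bounded representations `π` of `C_c(G)`. -/
def UniversalAlg : Type (u + 1) := lp (fun π : Rep 𝕜 s => π.H →L[𝕜] π.H) ∞

namespace UniversalAlg

instance : NonUnitalNormedRing (UniversalAlg 𝕜 s) := lp.nonUnitalNormedRing

instance : StarRing (UniversalAlg 𝕜 s) :=
  inferInstanceAs (StarRing (lp (fun π : Rep 𝕜 s => π.H →L[𝕜] π.H) ∞))

instance : CStarRing (UniversalAlg 𝕜 s) := 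
  inferInstanceAs (CStarRing (lp (fun π : Rep 𝕜 s => π.H →L[𝕜] π.H) ∞))

instance : CompleteSpace (UniversalAlg 𝕜 s) :=
  inferInstanceAs (CompleteSpace (lp (fun π : Rep 𝕜 s => π.H →L[𝕜] π.H) ∞))

instance : NormedSpace 𝕜 (UniversalAlg 𝕜 s) := lp.instNormedSpace

instance : IsScalarTower 𝕜 (UniversalAlg 𝕜 s) (UniversalAlg 𝕜 s) := lp.infty_isScalarTower

instance : SMulCommClass 𝕜 (UniversalAlg 𝕜 s) (UniversalAlg 𝕜 s) := lp.infty_smulCommClass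

instance : StarModule 𝕜 (UniversalAlg 𝕜 s) := 
  inferInstanceAs (StarModule 𝕜 (lp (fun π : Rep 𝕜 s => π.H →L[𝕜] π.H) ∞))

end UniversalAlg

/-- The universal representation `f ↦ (π(f))_π`; its norm is the full norm
`‖f‖ = sup_π ‖π(f)‖` of the groupoid algebra. -/
def universalRep : ConvAlg 𝕜 s →⋆ₙₐ[𝕜] UniversalAlg 𝕜 s where
  toFun f := (⟨fun π => π.toHom f, memℓp_infty ⟨f.iNorm, by
    rintro _ ⟨π, rfl⟩
    exact π.norm_le f⟩⟩ : lp (fun π : Rep 𝕜 s => π.H →L[𝕜] π.H) ∞)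
  map_smul' c f := Subtype.ext (funext fun π => map_smul π.toHom c f)
  map_zero' := Subtype.ext (funext fun π => map_zero π.toHom)
  map_add' f g := Subtype.ext (funext fun π => map_add π.toHom f g)
  map_mul' f g := Subtype.ext (funext fun π => map_mul π.toHom f g)
  map_star' f := Subtype.ext (funext fun π => map_star π.toHom f)

/-- The (full) groupoid `C⋆`-algebra `C⋆(G)`: the completion of `C_c(G)` in the norm
`‖f‖ = sup_π ‖π(f)‖`, realised as the closure of `C_c(G)` in its universal representation. -/
def CStarAlg : NonUnitalStarSubalgebra 𝕜 (UniversalAlg 𝕜 s) :=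
  (NonUnitalStarAlgHom.range (universalRep 𝕜 s)).topologicalClosure

/-- The canonical map `C_c(G) → C⋆(G)`. -/
def CStarAlg.ι : ConvAlg 𝕜 s →⋆ₙₐ[𝕜] CStarAlg 𝕜 s :=
  NonUnitalStarAlgHom.codRestrict (universalRep 𝕜 s) (CStarAlg 𝕜 s) fun f =>
    NonUnitalStarSubalgebra.le_topologicalClosure _ ⟨f, rfl⟩

instance : CStarRing (CStarAlg 𝕜 s) where
  norm_mul_self_le a := CStarRing.norm_mul_self_le (a : UniversalAlg 𝕜 s)

instance : CompleteSpace (CStarAlg 𝕜 s) :=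
  (NonUnitalStarSubalgebra.isClosed_topologicalClosure
    (NonUnitalStarAlgHom.range (universalRep 𝕜 s))).completeSpace_coe

end EquivRel

section Cylinder

variable {X : Type u} [TopologicalSpace X] (S : Set X)

/-- The gluing: `x ∈ S ⊆ X` is identified with `(x, 0) ∈ S × [0, ∞)`. -/
def attachRel (a b : X ⊕ (S × ℝ≥0)) : Prop :=
  ∃ x : S, a = Sum.inl (x : X) ∧ b = Sum.inr (x, 0)

/-- The space `X ∪_S (S × [0, ∞))`, with the quotient topology. -/
def AttachCylinder : Type u := Quot (attachRel S)

namespace AttachCylinder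

instance : TopologicalSpace (AttachCylinder S) :=
  inferInstanceAs (TopologicalSpace (Quot (attachRel S)))

variable {S}

/-- The image of `x ∈ X`. -/
def base (x : X) : AttachCylinder S := Quot.mk _ (Sum.inl x)

/-- The image of `(x, t) ∈ S × [0, ∞)`. -/
def cyl (p : S × ℝ≥0) : AttachCylinder S := Quot.mk _ (Sum.inr p)

theorem base_eq_cyl (x : S) : (base (x : X) : AttachCylinder S) = cyl (x, 0) :=
  Quot.sound ⟨x, rfl, rfl⟩

theorem continuous_base : Continuous (base : X → AttachCylinder S) :=
  continuous_quot_mk.comp continuous_inl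

theorem continuous_cyl : Continuous (cyl : S × ℝ≥0 → AttachCylinder S) :=
  continuous_quot_mk.comp continuous_inr

/-- Auxiliary to `toProd`. -/
def preProd : X ⊕ (S × ℝ≥0) → X × ℝ≥0 :=
  Sum.elim (fun x => (x, 0)) fun p => ((p.1 : X), p.2)

/-- The injection of `X ∪_S (S × [0, ∞))` into `X × [0, ∞)`. -/
def toProd : AttachCylinder S → X × ℝ≥0 :=
  Quot.lift preProd (by rintro _ _ ⟨x, rfl, rfl⟩; rfl)

theorem toProd_base (x : X) : toProd (base x : AttachCylinder S) = (x, 0) := rfl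

theorem toProd_cyl (p : S × ℝ≥0) : toProd (cyl p) = ((p.1 : X), p.2) := rfl

theorem injective_toProd : Function.Injective (toProd : AttachCylinder S → X × ℝ≥0) := by
  rintro ⟨a | ⟨a, t⟩⟩ ⟨b | ⟨b, r⟩⟩ h
  · exact congrArg base (Prod.ext_iff.1 h).1
  · obtain ⟨h1, h2⟩ := Prod.ext_iff.1 h
    obtain rfl : a = b := h1
    obtain rfl : 0 = r := h2
    exact base_eq_cyl b
  · obtain ⟨h1, h2⟩ := Prod.ext_iff.1 h
    obtain rfl : (a : X) = b := h1
    obtain rfl : t = 0 := h2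
    exact (base_eq_cyl a).symm
  · obtain ⟨h1, h2⟩ := Prod.ext_iff.1 h
    obtain rfl : a = b := Subtype.ext h1
    obtain rfl : t = r := h2
    rfl

theorem isClosedEmbedding_preCyl (hS : IsClosed S) :
    IsClosedEmbedding fun p : S × ℝ≥0 => ((p.1 : X), p.2) :=
  hS.isClosedEmbedding_subtypeVal.prodMap .id

theorem isClosedEmbedding_toProd (hS : IsClosed S) :
    IsClosedEmbedding (toProd : AttachCylinder S → X × ℝ≥0) := by
  have h1 : IsClosedEmbedding fun x : X => (x, (0 : ℝ≥0)) := by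
    refine .of_continuous_injective_isClosedMap (by fun_prop)
      (fun a b h => (Prod.ext_iff.1 h).1) fun C hC => ?_
    have : (fun x : X => (x, (0 : ℝ≥0))) '' C = C ×ˢ {0} := by
      ext ⟨a, b⟩; simp [eq_comm]
    rw [this]
    exact hC.prod isClosed_singleton
  have h2 := isClosedEmbedding_preCyl hS
  refine .of_continuous_injective_isClosedMap ?_ injective_toProd fun C hC => ?_
  · exact continuous_quot_lift _ (h1.continuous.sumElim h2.continuous)
  · have hq : IsClosed (Quot.mk (attachRel S) ⁻¹' C) := hC.preimage continuous_quot_mk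
    have : toProd '' C = preProd '' (Quot.mk (attachRel S) ⁻¹' C) := by
      ext p
      constructor
      · rintro ⟨⟨a⟩, ha, rfl⟩
        exact ⟨a, ha, rfl⟩
      · rintro ⟨a, ha, rfl⟩
        exact ⟨_, ha, rfl⟩
    rw [this]
    exact (h1.isClosedMap.sumElim h2.isClosedMap) _ hq

theorem isClosedEmbedding_cyl (hS : IsClosed S) :
    IsClosedEmbedding (cyl : S × ℝ≥0 → AttachCylinder S) :=
  IsClosedEmbedding.of_comp_iff (isClosedEmbedding_toProd hS) |>.1 (isClosedEmbedding_preCyl hS)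

theorem cyl_injective : Function.Injective (cyl : S × ℝ≥0 → AttachCylinder S) := by
  intro p q h
  have := congrArg toProd h
  exact Prod.ext (Subtype.ext (Prod.ext_iff.1 this).1) (Prod.ext_iff.1 this).2

theorem range_cyl_pos : cyl '' {p : S × ℝ≥0 | 0 < p.2} =
    {a : AttachCylinder S | 0 < (toProd a).2} := by
  ext a
  constructor
  · rintro ⟨p, hp, rfl⟩
    exact hp
  · intro ha
    obtain ⟨x | p⟩ := a
    · exact absurd (show (0 : ℝ≥0) < 0 from ha) (lt_irrefl _)
    · exact ⟨p, ha, rfl⟩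

end AttachCylinder

variable {S} {Y P : Type*}

open AttachCylinder in
/-- The relation on `X ∪_S (S × [0, ∞))` that is trivial on `X`, and for which
`(x, t) ∼ (y, r)` with `t, r > 0` if and only if `t = r` and `p x = p y`. -/
def cylinderSetoid (p : S → Y) : Setoid (AttachCylinder S) where
  r a b := a = b ∨ ∃ (x y : S) (t : ℝ≥0), 0 < t ∧ a = cyl (x, t) ∧ b = cyl (y, t) ∧ p x = p y
  iseqv := by
    refine ⟨fun a => .inl rfl, ?_, ?_⟩
    · rintro a b (rfl | ⟨x, y, t, ht, rfl, rfl, h⟩)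
      · exact .inl rfl
      · exact .inr ⟨y, x, t, ht, rfl, rfl, h.symm⟩
    · rintro a b c (rfl | ⟨x, y, t, ht, rfl, rfl, h⟩) h2
      · exact h2
      · rcases h2 with rfl | ⟨x', y', t', ht', e, rfl, h'⟩
        · exact .inr ⟨x, y, t, ht, rfl, rfl, h⟩
        · obtain ⟨rfl, rfl⟩ := Prod.ext_iff.1 (cyl_injective e)
          exact .inr ⟨x, y', t, ht, rfl, rfl, h.trans h'⟩

theorem isLocalHomeomorphOn_range {Z W : Type*} [TopologicalSpace Z] [TopologicalSpace W]
    {s : Setoid Z} {Q : W → EquivRel.Graph s} (h1 : IsOpenEmbedding Q)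
    (h2 : IsOpenEmbedding fun w => (Q w).1.1) :
    IsLocalHomeomorphOn (fun g : EquivRel.Graph s => g.1.1) (range Q) := by
  rw [← image_univ]
  exact IsLocalHomeomorphOn.of_comp_right (g := fun g : EquivRel.Graph s => g.1.1)
    h2.isLocalHomeomorph.isLocalHomeomorphOn h1.isLocalHomeomorph.isLocalHomeomorphOn

open AttachCylinder in
theorem isEtale_cylinderSetoid [TopologicalSpace Y] [T2Space Y] [TopologicalSpace P]
    [DiscreteTopology P] (hS : IsClosed S) [T2Space X] (φ : S ≃ₜ Y × P) :
    EquivRel.IsEtale (cylinderSetoid fun x => (φ x).1) := by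
  set s := cylinderSetoid fun x => (φ x).1 with hs
  have hT2 : T2Space (AttachCylinder S) := (isClosedEmbedding_toProd hS).isEmbedding.t2Space
  have hcyl := isClosedEmbedding_cyl hS
  refine ⟨isLocalHomeomorph_iff_isLocalHomeomorphOn_univ.2 fun g _ => ?_⟩
  rcases g.2 with h | ⟨x, y, t, ht, hx, hy, hxy⟩
  · -- near a unit
    have hK : IsClosed ((fun q : (S × ℝ≥0) × (S × ℝ≥0) => (cyl q.1, cyl q.2)) ''
        {q | (φ q.1.1).1 = (φ q.2.1).1 ∧ q.1.2 = q.2.2 ∧ (φ q.1.1).2 ≠ (φ q.2.1).2}) := by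
      refine (hcyl.prodMap hcyl).isClosedMap _ ?_
      refine (isClosed_eq (by fun_prop) (by fun_prop)).inter
        ((isClosed_eq (by fun_prop) (by fun_prop)).inter ?_)
      exact (isClosed_discrete {r : P × P | r.1 ≠ r.2}).preimage
        (f := fun q : (S × ℝ≥0) × (S × ℝ≥0) => ((φ q.1.1).2, (φ q.2.1).2)) (by fun_prop)
    refine isLocalHomeomorphOn_range (Q := fun a => (⟨(a, a), s.refl' a⟩ : EquivRel.Graph s))
      ⟨?_, ?_⟩ .id g ⟨g.1.1, Subtype.ext (Prod.ext rfl h)⟩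
    · exact IsEmbedding.of_comp (g := fun g : EquivRel.Graph s => g.1.1) (by fun_prop)
        (by fun_prop) .id
    · have : (range fun a => (⟨(a, a), s.refl' a⟩ : EquivRel.Graph s)) = 
        (Subtype.val ⁻¹' ((fun q : (S × ℝ≥0) × (S × ℝ≥0) => (cyl q.1, cyl q.2)) ''
        {q | (φ q.1.1).1 = (φ q.2.1).1 ∧ q.1.2 = q.2.2 ∧ (φ q.1.1).2 ≠ (φ q.2.1).2}))ᶜ := by
        ext ⟨⟨a, b⟩, hab⟩
        simp only [mem_range, mem_compl_iff, mem_preimage]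
        constructor
        · rintro ⟨c, hc⟩ ⟨⟨⟨x, t⟩, ⟨y, r⟩⟩, ⟨h1, h2, h3⟩, h4⟩
          have e1 : c = a := congrArg (fun g : EquivRel.Graph s => g.1.1) hc
          have e2 : c = b := congrArg (fun g : EquivRel.Graph s => g.1.2) hc
          have e3 : cyl (x, t) = a := (Prod.ext_iff.1 h4).1
          have e4 : cyl (y, r) = b := (Prod.ext_iff.1 h4).2
          have e5 := cyl_injective (e3.trans (e1.symm.trans (e2.trans e4.symm)))
          apply h3
          rw [show x = y from (Prod.ext_iff.1 e5).1]
        · intro hn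
          rcases hab with h | ⟨x, y, t, ht, hx, hy, hxy⟩
          · exact ⟨a, Subtype.ext (Prod.ext rfl h)⟩
          · have hx : a = cyl (x, t) := hx
            have hy : b = cyl (y, t) := hy
            by_cases hp : (φ x).2 = (φ y).2
            · have : x = y := φ.injective (Prod.ext hxy hp)
              refine ⟨a, Subtype.ext (Prod.ext rfl ?_)⟩
              change a = b
              rw [hx, hy, this]
            · exact absurd ⟨((x, t), (y, t)), ⟨hxy, rfl, hp⟩, Prod.ext hx.symm hy.symm⟩ hn
      rw [this]
      exact (hK.preimage continuous_subtype_val).isOpen_compl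
  · -- over the open cylinder
    let Pm : P → Y × {r : ℝ≥0 // 0 < r} → AttachCylinder S := fun i w =>
      cyl (φ.symm (w.1, i), (w.2 : ℝ≥0))
    have hopen : IsOpenEmbedding fun q : S × {r : ℝ≥0 // 0 < r} => 
        (cyl (q.1, (q.2 : ℝ≥0)) : AttachCylinder S) := by
      have he : IsOpenEmbedding fun q : S × {r : ℝ≥0 // 0 < r} => (q.1, (q.2 : ℝ≥0)) :=
        IsOpenEmbedding.id.prodMap (isOpen_lt continuous_const continuous_id).isOpenEmbedding_subtypeVal
      refine ⟨hcyl.isEmbedding.comp he.isEmbedding, ?_⟩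
      have : (range fun q : S × {r : ℝ≥0 // 0 < r} =>
          (cyl (q.1, (q.2 : ℝ≥0)) : AttachCylinder S)) = {a | 0 < (toProd a).2} := by
        rw [← range_cyl_pos]
        ext a
        constructor
        · rintro ⟨q, rfl⟩
          exact ⟨_, q.2.2, rfl⟩
        · rintro ⟨q, hq, rfl⟩
          exact ⟨(q.1, ⟨q.2, hq⟩), rfl⟩
      rw [this]
      exact isOpen_lt continuous_const
        (continuous_snd.comp (isClosedEmbedding_toProd hS).continuous)
    have hPm : ∀ i, IsOpenEmbedding (Pm i) := by
      intro i
      have h1 : IsOpenEmbedding fun b : Y => (b, i) := by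
        refine ⟨.of_comp (g := Prod.fst) (by fun_prop) (by fun_prop) .id, ?_⟩
        have : (range fun b : Y => (b, i)) = Prod.snd ⁻¹' {i} := by
          ext ⟨a, j⟩; simp [eq_comm]
        rw [this]
        exact (isOpen_discrete {i}).preimage continuous_snd
      have h2 : IsOpenEmbedding fun w : Y × {r : ℝ≥0 // 0 < r} => (φ.symm (w.1, i), w.2) :=
        (φ.symm.isOpenEmbedding.comp h1).prodMap .id
      exact hopen.comp h2
    have hrel : ∀ i j w, s (Pm i w) (Pm j w) := fun i j w =>
      .inr ⟨_, _, _, w.2.2, rfl, rfl, by simp⟩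
    refine isLocalHomeomorphOn_range
      (Q := fun w => (⟨(Pm (φ x).2 w, Pm (φ y).2 w), hrel _ _ _⟩ : EquivRel.Graph s))
      ⟨?_, ?_⟩ (hPm _) g ⟨((φ x).1, ⟨t, ht⟩), Subtype.ext (Prod.ext ?_ ?_)⟩
    · exact IsEmbedding.of_comp (g := fun g : EquivRel.Graph s => g.1.1)
        (((hPm _).continuous.prodMk (hPm _).continuous).subtype_mk _)
        (by fun_prop) (hPm _).isEmbedding
    · have : (range fun w => (⟨(Pm (φ x).2 w, Pm (φ y).2 w), hrel _ _ _⟩ : EquivRel.Graph s)) =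
          (fun g : EquivRel.Graph s => g.1.1) ⁻¹' range (Pm (φ x).2) ∩
            (fun g : EquivRel.Graph s => g.1.2) ⁻¹' range (Pm (φ y).2) := by
        ext ⟨⟨a, b⟩, hab⟩
        constructor
        · rintro ⟨w, hw⟩
          exact ⟨⟨w, congrArg (fun g : EquivRel.Graph s => g.1.1) hw⟩,
            ⟨w, congrArg (fun g : EquivRel.Graph s => g.1.2) hw⟩⟩
        · rintro ⟨⟨w, hw⟩, ⟨w', hw'⟩⟩
          have hw : Pm (φ x).2 w = a := hw
          have hw' : Pm (φ y).2 w' = b := hw'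
          have hww : w = w' := by
            rcases hab with h | ⟨x', y', t', ht', hx', hy', hxy'⟩
            · have h : a = b := h
              have e := cyl_injective (hw.trans (h.trans hw'.symm))
              have e1 := (Prod.ext_iff.1 (φ.symm.injective (Prod.ext_iff.1 e).1)).1
              exact Prod.ext e1 (Subtype.ext (Prod.ext_iff.1 e).2)
            · have e := Prod.ext_iff.1 (cyl_injective (hw.trans hx'))
              have e' := Prod.ext_iff.1 (cyl_injective (hw'.trans hy'))
              refine Prod.ext ?_ (Subtype.ext (e.2.trans e'.2.symm))
              have h1 : φ.symm (w.1, (φ x).2) = x' := e.1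
              have h2 : φ.symm (w'.1, (φ y).2) = y' := e'.1
              have h3 : (φ x').1 = (φ y').1 := hxy'
              rw [← h1, ← h2] at h3
              simpa using h3
          subst hww
          exact ⟨w, Subtype.ext (Prod.ext hw hw')⟩
      rw [this]
      exact ((hPm _).isOpen_range.preimage (by fun_prop)).inter
        ((hPm _).isOpen_range.preimage (by fun_prop))
    · change Pm (φ x).2 _ = g.1.1
      rw [hx]
      simp [Pm]
    · change Pm (φ y).2 _ = g.1.2
      have hxy : (φ x).1 = (φ y).1 := hxy
      rw [hy]
      simp [Pm, hxy]

end Cylinder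

section Tensor

open scoped Matrix.Norms.L2Operator

variable (𝕜 : Type) [RCLike 𝕜] (k : ℕ) (B : Type v) [TopologicalSpace B] [CompactSpace B]

variable {𝕜 k B} in
/-- The function `(t, b) ↦ f(t) g(b) a` given by an elementary tensor `f ⊗ g ⊗ a`. -/
def elemTensor (f : C₀(ℝ, 𝕜)) (g : C(B, 𝕜)) (a : Matrix (Fin k) (Fin k) 𝕜) :
    C₀(ℝ × B, Matrix (Fin k) (Fin k) 𝕜) where
  toFun z := (f z.1 * g z.2) • a
  continuous_toFun := by fun_prop
  zero_at_infty' := by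
    have h1 : Tendsto (fun z : ℝ × B => f z.1) (cocompact (ℝ × B)) (𝓝 0) := by
      refine (zero_at_infty f).comp ?_
      rw [← coprod_cocompact, cocompact_eq_bot (X := B), coprod_bot]
      exact tendsto_comap
    have h2 : Tendsto (fun z : ℝ × B => ‖f z.1‖ * (‖g‖ * ‖a‖)) (cocompact (ℝ × B)) (𝓝 0) := by
      simpa using h1.norm.mul_const (‖g‖ * ‖a‖)
    refine squeeze_zero_norm (fun z => ?_) h2
    rw [norm_smul, norm_mul, mul_assoc]
    gcongr
    exact g.norm_coe_le_norm z.2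

theorem elemTensor_apply (f : C₀(ℝ, 𝕜)) (g : C(B, 𝕜)) (a : Matrix (Fin k) (Fin k) 𝕜) (z : ℝ × B) :
    elemTensor f g a z = (f z.1 * g z.2) • a := rfl

/-- The algebraic tensor product `C₀(ℝ) ⊙ C(B) ⊙ M_k`, mapped to matrix-valued functions on `ℝ × B`. -/
def tensorMap : C₀(ℝ, 𝕜) ⊗[𝕜] (C(B, 𝕜) ⊗[𝕜] Matrix (Fin k) (Fin k) 𝕜) →ₗ[𝕜]
    C₀(ℝ × B, Matrix (Fin k) (Fin k) 𝕜) :=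
  TensorProduct.lift
    { toFun := fun f => TensorProduct.lift (LinearMap.mk₂ 𝕜 (fun g a => elemTensor f g a)
        (fun g g' a => by ext1 z; simp [elemTensor_apply, mul_add, add_smul])
        (fun c g a => by
          ext1 z; simp [elemTensor_apply, smul_smul, mul_left_comm])
        (fun g a a' => by ext1 z; simp [elemTensor_apply])
        (fun c g a => by ext1 z; simp [elemTensor_apply, smul_smul, mul_comm]))
      map_add' := fun f f' => TensorProduct.ext' fun g a => by
        ext1 z; simp [elemTensor_apply, add_mul, add_smul]
      map_smul' := fun c f => TensorProduct.ext' fun g a => by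
        ext1 z; simp [elemTensor_apply, smul_smul, mul_assoc] }

variable {𝕜 k B} in
theorem tensorMap_tmul (f : C₀(ℝ, 𝕜)) (g : C(B, 𝕜)) (a : Matrix (Fin k) (Fin k) 𝕜) :
    tensorMap 𝕜 k B (f ⊗ₜ (g ⊗ₜ a)) = elemTensor f g a := by
  simp [tensorMap]

theorem range_tensorMap : LinearMap.range (tensorMap 𝕜 k B) = Submodule.span 𝕜
    {x | ∃ (f : C₀(ℝ, 𝕜)) (g : C(B, 𝕜)) (a : Matrix (Fin k) (Fin k) 𝕜),
      x = elemTensor f g a} := by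
  apply le_antisymm
  · rintro _ ⟨x, rfl⟩
    induction x using TensorProduct.induction_on with
    | zero => simp
    | add x y hx hy => rw [map_add]; exact add_mem hx hy
    | tmul f y =>
      induction y using TensorProduct.induction_on with
      | zero => simp
      | add x y hx hy => rw [TensorProduct.tmul_add, map_add]; exact add_mem hx hy
      | tmul g a => exact Submodule.subset_span ⟨f, g, a, tensorMap_tmul f g a⟩
  · rw [Submodule.span_le]
    rintro _ ⟨f, g, a, rfl⟩
    exact ⟨_, tensorMap_tmul f g a⟩

variable {𝕜 k B} in
theorem elemTensor_mul (f f' : C₀(ℝ, 𝕜)) (g g' : C(B, 𝕜)) (a a' : Matrix (Fin k) (Fin k) 𝕜) :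
    elemTensor f g a * elemTensor f' g' a' = elemTensor (f * f') (g * g') (a * a') := by
  ext1 z
  simp only [ZeroAtInftyContinuousMap.mul_apply, elemTensor_apply, ContinuousMap.mul_apply,
    smul_mul_smul_comm]
  congr 1
  ring

variable {𝕜 k B} in
theorem elemTensor_star (f : C₀(ℝ, 𝕜)) (g : C(B, 𝕜)) (a : Matrix (Fin k) (Fin k) 𝕜) :
    star (elemTensor f g a) = elemTensor (star f) (star g) (star a) := by
  ext1 z
  simp [elemTensor_apply, star_smul, mul_comm]

/-- The image of `C₀(ℝ) ⊙ C(B) ⊙ M_k` under `tensorMap`, a `⋆`-algebra. -/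
def algTensor : NonUnitalStarSubalgebra 𝕜 C₀(ℝ × B, Matrix (Fin k) (Fin k) 𝕜) where
  carrier := LinearMap.range (tensorMap 𝕜 k B)
  add_mem' := add_mem
  zero_mem' := zero_mem _
  smul_mem' c _ hx := Submodule.smul_mem _ c hx
  mul_mem' {x y} hx hy := by
    rw [range_tensorMap] at hx hy ⊢
    induction hx using Submodule.span_induction with
    | zero => rw [zero_mul]; exact zero_mem _
    | add x x' _ _ h h' => rw [add_mul]; exact add_mem h h'
    | smul c x _ h => rw [smul_mul_assoc]; exact Submodule.smul_mem _ c h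
    | mem x hx =>
      obtain ⟨f, g, a, rfl⟩ := hx
      induction hy using Submodule.span_induction with
      | zero => rw [mul_zero]; exact zero_mem _
      | add x x' _ _ h h' => rw [mul_add]; exact add_mem h h'
      | smul c x _ h => rw [mul_smul_comm]; exact Submodule.smul_mem _ c h
      | mem y hy =>
        obtain ⟨f', g', a', rfl⟩ := hy
        exact Submodule.subset_span ⟨_, _, _, elemTensor_mul f f' g g' a a'⟩
  star_mem' {x} hx := by
    rw [range_tensorMap] at hx ⊢
    induction hx using Submodule.span_induction with
    | zero => rw [star_zero]; exact zero_mem _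
    | add x x' _ _ h h' => rw [star_add]; exact add_mem h h'
    | smul c x _ h => rw [star_smul]; exact Submodule.smul_mem _ _ h
    | mem x hx =>
      obtain ⟨f, g, a, rfl⟩ := hx
      exact Submodule.subset_span ⟨_, _, _, elemTensor_star f g a⟩

/-- The `C⋆`-tensor product `C₀(ℝ) ⊗ C(B) ⊗ M_k`: the completion of the algebraic tensor product in
its (unique) `C⋆`-norm `‖∑ f ⊗ g ⊗ a‖ = sup_{t, b} ‖∑ f(t) g(b) a‖`, with the operator norm on `M_k`. -/
def cstarTensor : NonUnitalStarSubalgebra 𝕜 C₀(ℝ × B, Matrix (Fin k) (Fin k) 𝕜) :=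
  (algTensor 𝕜 k B).topologicalClosure

end Tensor

section Mfd

open Manifold

/-- A model with corners for manifolds with boundary: its image is a closed half-space `{l ≥ 0}`, or
(for `l = 0`) the whole vector space, for manifolds with empty boundary. -/
class HalfSpaceModel {E H : Type*} [NormedAddCommGroup E] [NormedSpace ℝ E] [TopologicalSpace H]
    (I : ModelWithCorners ℝ E H) : Prop where
  range_eq : ∃ l : E →L[ℝ] ℝ, range I = {v | 0 ≤ l v}

/-- A `ℤ/k`-structure on a manifold with boundary `M`: a diffeomorphism `φ : ∂M → B × ℤ/k`, where `B`
(written `βM` in the literature) is a manifold and `ℤ/k` is discrete. Here `∂M` has its usual smooth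
structure, the one that makes `∂M → M` a smooth embedding; so a homeomorphism `φ` is a
diffeomorphism if and only if `φ⁻¹`, as a map to `M`, is a smooth embedding. -/
structure ZkStructure {E H : Type*} [NormedAddCommGroup E] [NormedSpace ℝ E] [TopologicalSpace H]
    (I : ModelWithCorners ℝ E H) (M : Type u) [TopologicalSpace M] [ChartedSpace H M]
    (d : ℕ) (B : Type v) [TopologicalSpace B] [ChartedSpace (EuclideanSpace ℝ (Fin d)) B]
    (k : ℕ) where
  φ : I.boundary M ≃ₜ B × ZMod k
  isSmoothEmbedding_symm :
    letI : ChartedSpace (EuclideanSpace ℝ (Fin 0)) (ZMod k) := ChartedSpace.ofDiscreteTopology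
    IsSmoothEmbedding ((𝓡 d).prod (𝓡 0)) I ∞ fun y => (φ.symm y : M)

namespace ZkStructure

variable {E H : Type*} [NormedAddCommGroup E] [NormedSpace ℝ E] [TopologicalSpace H]
  {I : ModelWithCorners ℝ E H} {M : Type u} [TopologicalSpace M] [ChartedSpace H M]
  {d : ℕ} {B : Type v} [TopologicalSpace B] [ChartedSpace (EuclideanSpace ℝ (Fin d)) B]
  {k : ℕ} (σ : ZkStructure I M d B k)

/-- The manifold `N = M ∪_{∂M} (∂M × [0, ∞))` with cylinders attached. -/
def N (_σ : ZkStructure I M d B k) : Type u := AttachCylinder (I.boundary M)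

instance : TopologicalSpace σ.N := inferInstanceAs (TopologicalSpace (AttachCylinder _))

/-- The projection `p : ∂M → B`, which is `φ` followed by the projection to the first factor. -/
def p (x : I.boundary M) : B := (σ.φ x).1

/-- The equivalence relation `∼` on `N`: points of `M` are equivalent only to themselves, and
`(x, t) ∼ (y, r)`, for `x, y ∈ ∂M` and `t, r > 0`, if and only if `t = r` and `p x = p y`. -/
def rel : Setoid σ.N := cylinderSetoid σ.p

theorem isClosed_boundary (σ : ZkStructure I M d B k) [T2Space M] [CompactSpace B] [NeZero k] : IsClosed (I.boundary M) := by
  have : CompactSpace (I.boundary M) := Homeomorph.compactSpace σ.φ.symm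
  exact (isCompact_iff_compactSpace.2 this).isClosed

instance [T2Space M] [CompactSpace B] [NeZero k] : T2Space σ.N :=
  (AttachCylinder.isClosedEmbedding_toProd σ.isClosed_boundary).isEmbedding.t2Space

instance [T2Space M] [CompactSpace M] [CompactSpace B] [NeZero k] : LocallyCompactSpace σ.N :=
  (AttachCylinder.isClosedEmbedding_toProd σ.isClosed_boundary).locallyCompactSpace

/-- The groupoid of `∼` is étale. -/
instance [T2Space M] [T2Space B] [CompactSpace B] [NeZero k] : EquivRel.IsEtale σ.rel :=
  isEtale_cylinderSetoid σ.isClosed_boundary σ.φ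

/-- The image in `N` of a point of `M`. -/
def ofM (x : M) : σ.N := (AttachCylinder.base x : AttachCylinder (I.boundary M))

variable (𝕜 : Type) [RCLike 𝕜]

/-- The `C⋆`-algebra `C⋆(M; ℤ/k)` over `𝕜`: the groupoid `C⋆`-algebra of the relation `∼` on `N`. -/
abbrev CStar [T2Space M] [T2Space B] [CompactSpace B] [NeZero k] :=
  EquivRel.CStarAlg 𝕜 σ.rel

end ZkStructure

end Mfd

end

noncomputable section

open Set Filter Topology
open scoped NNReal ENNReal ZeroAtInfty TensorProduct CompactlySupported

set_option linter.unusedSectionVars false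

universe u v

/-! ### Automatic contractivity and extension of ⋆-homomorphisms -/

section Abstract

/-! Every class of `∼` is finite: a single point on `M`, and `k` points, one on each sheet of the
cylinder, over each height and each `b ∈ B`. Restricting `f ∈ C_c(G)` to a class gives a matrix.
Writing the positive heights as `exp t`, these matrices form a bounded `M_k`-valued function on `ℝ ×
B`, together with the function `x ↦ f(x, x)` on `M`. This pair is `totalRep f`.

The full norm is the norm of this pair (`norm_totalRep`). Each class representation is bounded by
the `I`-norm, by Schur's test, so it occurs in the supremum. Conversely, classes have at most `k +
1` elements, so the `I`-norm is at most `(k + 1) ‖totalRep f‖`; hence every admissible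
representation is bounded by that multiple of `‖totalRep f‖`, and the constant disappears by
applying the C⋆-identity to iterated squares (`norm_sq_le_of_le_mul`). No spectral theory enters, so
real and complex scalars are treated alike.

Thus `totalRep` extends to an isometric embedding `Θ` of `C⋆(G)`, and `q` is its second component.
The range of `Θ` contains all pairs `(F, 0)` with `F` in `C₀(ℝ × B, M_k)`: compactly supported `F`
extend by zero to elements of `C_c(G)` (`exists_totalRep_eq`), and the range is closed. Conversely,
if `f` vanishes on the units in `M`, its matrix function vanishes at infinity
(`cylinderRep_mem_range`); general elements of `ker q` are limits of such `f`, because functions on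
`M` lift to `C_c(G)` without increase of norm (`exists_baseRep_eq`). The same lift makes `q`
surjective. Finally, `cstarTensor` is all of `C₀(ℝ × B, M_k)`, by a partition of unity on `ℝ`. -/

theorem le_of_forall_pow_two_pow_le {x y C : ℝ} (hy : 0 ≤ y)
    (h : ∀ n : ℕ, x ^ 2 ^ n ≤ C * y ^ 2 ^ n) : x ≤ y := by
  by_contra! hxy
  rcases hy.eq_or_lt with rfl | hy
  · have := h 0
    simp only [pow_zero, pow_one, mul_zero] at this
    exact absurd hxy this.not_gt
  · have h1 : 1 < x / y := (one_lt_div hy).2 hxy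
    obtain ⟨n, hn⟩ := pow_unbounded_of_one_lt C h1
    have h2 : (x / y) ^ n ≤ (x / y) ^ 2 ^ n := pow_le_pow_right₀ h1.le Nat.lt_two_pow_self.le
    have h3 : (x / y) ^ 2 ^ n ≤ C := by
      rw [div_pow, div_le_iff₀ (by positivity)]
      exact h n
    exact absurd hn (h2.trans h3).not_gt

/-- A `⋆`-homomorphism to a `C⋆`-ring that is bounded by a multiple of a submultiplicative function
`N` satisfies the `C⋆`-estimate `‖φ a‖² ≤ N (a⋆ a)`. -/
theorem norm_sq_le_of_le_mul {R A : Type*} [NonUnitalRing R] [StarRing R] [NonUnitalNormedRing A]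
    [StarRing A] [CStarRing A] {F : Type*} [FunLike F R A] [MulHomClass F R A] [StarHomClass F R A]
    (φ : F) (N : R → ℝ) (hN : ∀ a, 0 ≤ N a) (hmul : ∀ a b, N (a * b) ≤ N a * N b)
    {C : ℝ} (hC : ∀ a, ‖φ a‖ ≤ C * N a) (a : R) : ‖φ a‖ * ‖φ a‖ ≤ N (star a * a) := by
  -- Here `h'` is the `2 ^ n`-th power of `h`, built by repeated squaring. On self-adjoint elements
  -- the C⋆-identity makes the norm exactly multiplicative under squaring, while `N` is only
  -- submultiplicative.
  have key : ∀ (n : ℕ) (h : R), IsSelfAdjoint h →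
      ∃ h', IsSelfAdjoint h' ∧ ‖φ h'‖ = ‖φ h‖ ^ 2 ^ n ∧ N h' ≤ N h ^ 2 ^ n := by
    intro n
    induction n with
    | zero => exact fun h hh => ⟨h, hh, by simp, by simp⟩
    | succ n ih =>
      intro h hh
      obtain ⟨h', h1, h2, h3⟩ := ih h hh
      refine ⟨h' * h', ?_, ?_, ?_⟩
      · rw [IsSelfAdjoint, star_mul, h1.star_eq]
      · have h4 : star (φ h') = φ h' := by rw [← map_star, h1.star_eq]
        rw [map_mul]
        nth_rewrite 1 [← h4]
        rw [CStarRing.norm_star_mul_self, h2, ← pow_two, ← pow_mul, pow_succ]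
      · refine (hmul _ _).trans ?_
        rw [pow_succ, pow_mul, pow_two]
        exact mul_le_mul h3 h3 (hN _) (by positivity [hN h])
  have h1 : IsSelfAdjoint (star a * a) := IsSelfAdjoint.star_mul_self a
  have h2 : ‖φ (star a * a)‖ = ‖φ a‖ * ‖φ a‖ := by
    rw [map_mul, map_star, CStarRing.norm_star_mul_self]
  rw [← h2]
  have hC' : ∀ b, ‖φ b‖ ≤ |C| * N b := fun b =>
    (hC b).trans (mul_le_mul_of_nonneg_right (le_abs_self C) (hN b))
  -- The constant is the same for every power, so it is lost on taking `2 ^ n`-th roots.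
  refine le_of_forall_pow_two_pow_le (C := |C|) (hN _) fun n => ?_
  obtain ⟨h', -, h3, h4⟩ := key n _ h1
  rw [← h3]
  exact (hC' h').trans (mul_le_mul_of_nonneg_left h4 (abs_nonneg C))

/-- A `⋆`-homomorphism between `C⋆`-rings, defined on a `⋆`-ring mapping to the first one, is
contractive as soon as it is bounded. -/
theorem norm_le_norm_of_le_mul {R A T : Type*} [NonUnitalRing R] [StarRing R]
    [NonUnitalNormedRing A] [StarRing A] [CStarRing A]
    [NonUnitalNormedRing T] [StarRing T] [CStarRing T]
    {F G : Type*} [FunLike F R A] [MulHomClass F R A] [StarHomClass F R A]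
    [FunLike G R T] [MulHomClass G R T] [StarHomClass G R T]
    (φ : F) (θ : G) {C : ℝ} (hC : ∀ a, ‖φ a‖ ≤ C * ‖θ a‖) (a : R) : ‖φ a‖ ≤ ‖θ a‖ := by
  have h := norm_sq_le_of_le_mul φ (fun a => ‖θ a‖) (fun _ => norm_nonneg _)
    (fun a b => by rw [map_mul]; exact norm_mul_le _ _) hC a
  simp only [map_mul, map_star, CStarRing.norm_star_mul_self] at h
  exact (mul_self_le_mul_self_iff (norm_nonneg _) (norm_nonneg _)).2 h

variable {𝕜 R A T : Type*} [RCLike 𝕜] [NonUnitalRing R] [StarRing R] [Module 𝕜 R]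
  [NonUnitalNormedRing A] [StarRing A] [CStarRing A] [NormedSpace 𝕜 A]
  [NonUnitalNormedRing T] [StarRing T] [CStarRing T] [NormedSpace 𝕜 T]

/-- An isometric extension of `θ` along a map `ι` with dense range. -/
theorem exists_isometric_extension [CompleteSpace T] (ι : R →⋆ₙₐ[𝕜] A) (hι : DenseRange ι)
    (θ : R →⋆ₙₐ[𝕜] T) (h : ∀ f, ‖θ f‖ = ‖ι f‖) :
    ∃ Θ : A →⋆ₙₐ[𝕜] T, (∀ f, Θ (ι f) = θ f) ∧ ∀ a, ‖Θ a‖ = ‖a‖ := by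
  -- With the metric pulled back along `ι`, which need not be injective, `ι` is uniformly inducing
  -- and `θ` is an isometry. All algebraic identities then pass to the extension by density.
  let _ : PseudoMetricSpace R := PseudoMetricSpace.induced ι inferInstance
  have hui : IsUniformInducing ι := ⟨rfl⟩
  have huc : UniformContinuous θ := by
    refine Isometry.uniformContinuous (Isometry.of_dist_eq fun f g => ?_)
    change _ = dist (ι f) (ι g)
    rw [dist_eq_norm, dist_eq_norm, ← map_sub, ← map_sub, h]
  set Θ : A → T := (hui.isDenseInducing hι).extend θ
  have hc : Continuous Θ := (uniformContinuous_uniformly_extend hui hι huc).continuous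
  have he : ∀ f, Θ (ι f) = θ f := fun f => uniformly_extend_of_ind hui hι huc f
  refine ⟨{ toFun := Θ
            map_smul' := fun c a => hι.induction_on a
              (isClosed_eq (hc.comp (continuous_const_smul c)) (hc.const_smul c))
              fun f => by rw [← map_smul, he, he, map_smul]; rfl
            map_zero' := by rw [← map_zero ι, he, map_zero]
            map_add' := hι.induction_on₂ (isClosed_eq (by fun_prop) (by fun_prop))
              fun f g => by rw [← map_add, he, he, he, map_add]
            map_mul' := hι.induction_on₂ (isClosed_eq (by fun_prop) (by fun_prop))
              fun f g => by rw [← map_mul, he, he, he, map_mul]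
            map_star' := fun a => hι.induction_on a (isClosed_eq (by fun_prop) (by fun_prop))
              fun f => by rw [← map_star, he, he, map_star] }, he,
    fun a => hι.induction_on a (isClosed_eq hc.norm continuous_norm) fun f => ?_⟩
  rw [← h]
  exact congrArg norm (he f)

/-- Injectivity of `Θ` makes the chosen preimages unique, hence compatible with all operations. This
produces the left-hand map of the exact sequence from an explicit map into the target of `Θ`. -/
theorem exists_lift_of_range_subset {P : Type*} [NonUnitalNonAssocSemiring P] [Star P]
    [DistribMulAction 𝕜 P]
    (Θ : A →⋆ₙₐ[𝕜] T) (hΘ : Function.Injective Θ) (j : P →⋆ₙₐ[𝕜] T)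
    (hj : ∀ z, ∃ a, Θ a = j z) : ∃ i : P →⋆ₙₐ[𝕜] A, ∀ z, Θ (i z) = j z := by
  choose i hi using hj
  exact ⟨{ toFun := i
           map_smul' := fun c z => hΘ (by simp [hi])
           map_zero' := hΘ (by simp [hi])
           map_add' := fun y z => hΘ (by simp [hi])
           map_mul' := fun y z => hΘ (by simp [hi])
           map_star' := fun z => hΘ (by simp [hi, map_star]) }, hi⟩

end Abstract

/-! ### Operator norm and row sums of matrices -/

section MatrixNorm

open scoped Matrix.Norms.L2Operator

variable {𝕜 : Type} [RCLike 𝕜] {ι : Type*} [Fintype ι] [DecidableEq ι]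

/-- By the C⋆-identity the norm can be read off from `E E⋆`, which is diagonal with the single
possibly nonzero entry `|c|²`. -/
theorem norm_single_l2 (i j : ι) (c : 𝕜) : ‖Matrix.single i j c‖ ≤ ‖c‖ := by
  have h : Matrix.single i j c * star (Matrix.single i j c) =
      Matrix.diagonal (Pi.single i (c * star c)) := by
    rw [Matrix.star_eq_conjTranspose, Matrix.conjTranspose_single, Matrix.single_mul_single_same,
      Matrix.diagonal_single]
  have h2 := CStarRing.norm_self_mul_star (x := Matrix.single i j c)
  rw [h, Matrix.l2_opNorm_diagonal] at h2
  have h3 : ‖(Pi.single i (c * star c) : ι → 𝕜)‖ ≤ ‖c‖ * ‖c‖ := by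
    rw [pi_norm_le_iff_of_nonneg (by positivity)]
    intro l
    by_cases hl : l = i
    · subst hl; simp
    · simp [hl]; positivity
  exact (mul_self_le_mul_self_iff (norm_nonneg _) (norm_nonneg _)).2 (h2.symm.trans_le h3)

theorem norm_le_sum_norm_entry (A : Matrix ι ι 𝕜) : ‖A‖ ≤ ∑ i, ∑ j, ‖A i j‖ := by
  nth_rewrite 1 [Matrix.matrix_eq_sum_single A]
  refine (norm_sum_le _ _).trans (Finset.sum_le_sum fun i _ => (norm_sum_le _ _).trans
    (Finset.sum_le_sum fun j _ => norm_single_l2 i j _))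

theorem norm_entry_le_l2 (A : Matrix ι ι 𝕜) (i j : ι) : ‖A i j‖ ≤ ‖A‖ := by
  have h := Matrix.l2_opNorm_mulVec A (EuclideanSpace.single j 1)
  have h2 := PiLp.norm_apply_le (WithLp.toLp 2 (A.mulVec (EuclideanSpace.single j (1 : 𝕜)).ofLp)) i
  simpa using h2.trans h

/-- The maximal row sum of a matrix. -/
def rowNorm (A : Matrix ι ι 𝕜) : ℝ := ⨆ i, ∑ j, ‖A i j‖

theorem row_le_rowNorm (A : Matrix ι ι 𝕜) (i : ι) : ∑ j, ‖A i j‖ ≤ rowNorm A :=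
  le_ciSup (f := fun i => ∑ j, ‖A i j‖) (Set.finite_range _).bddAbove i

theorem rowNorm_nonneg (A : Matrix ι ι 𝕜) : 0 ≤ rowNorm A :=
  Real.iSup_nonneg fun _ => Finset.sum_nonneg fun _ _ => norm_nonneg _

theorem rowNorm_mul (A A' : Matrix ι ι 𝕜) : rowNorm (A * A') ≤ rowNorm A * rowNorm A' := by
  refine Real.iSup_le (fun i => ?_) (mul_nonneg (rowNorm_nonneg A) (rowNorm_nonneg A'))
  calc ∑ j, ‖(A * A') i j‖ ≤ ∑ j, ∑ l, ‖A i l‖ * ‖A' l j‖ := by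
        refine Finset.sum_le_sum fun j _ => ?_
        rw [Matrix.mul_apply]
        exact (norm_sum_le _ _).trans_eq (by simp only [norm_mul])
    _ = ∑ l, ‖A i l‖ * ∑ j, ‖A' l j‖ := by
        rw [Finset.sum_comm]; simp only [Finset.mul_sum]
    _ ≤ ∑ l, ‖A i l‖ * rowNorm A' := by
        gcongr with l; exact row_le_rowNorm A' l
    _ ≤ rowNorm A * rowNorm A' := by
        rw [← Finset.sum_mul]
        exact mul_le_mul_of_nonneg_right (row_le_rowNorm A i) (rowNorm_nonneg A')

/-- A crude bound is enough: `norm_sq_le_of_le_mul` removes the dimension-dependent constant. -/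
theorem norm_le_card_mul_rowNorm (A : Matrix ι ι 𝕜) : ‖A‖ ≤ Fintype.card ι * rowNorm A := by
  refine (norm_le_sum_norm_entry A).trans ?_
  refine (Finset.sum_le_card_nsmul _ _ (rowNorm A) fun i _ => row_le_rowNorm A i).trans ?_
  simp

/-- Reindexing a matrix does not change its operator norm. -/
theorem norm_reindex_le {κ : Type*} [Fintype κ] [DecidableEq κ] (e : κ ≃ ι) (A : Matrix ι ι 𝕜) :
    ‖A.submatrix e e‖ ≤ ‖A‖ := by
  let φ : Matrix ι ι 𝕜 →⋆ₙₐ[𝕜] Matrix κ κ 𝕜 :=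
    { toFun := fun A => A.submatrix e e
      map_smul' := fun _ _ => rfl
      map_zero' := rfl
      map_add' := fun _ _ => rfl
      map_mul' := fun A B => (Matrix.submatrix_mul_equiv A B e e e).symm
      map_star' := fun _ => rfl }
  -- Since reindexing is a ⋆-homomorphism, any bound by a multiple of the norm gives contractivity;
  -- the entrywise estimate supplies the constant `card κ ^ 2`.
  refine norm_le_norm_of_le_mul φ (NonUnitalStarAlgHom.id 𝕜 (Matrix ι ι 𝕜))
    (C := Fintype.card κ * Fintype.card κ) (fun A => ?_) A
  refine (norm_le_sum_norm_entry (φ A)).trans ?_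
  refine (Finset.sum_le_sum fun i _ => Finset.sum_le_sum fun j _ =>
    norm_entry_le_l2 A (e i) (e j)).trans_eq ?_
  simp [mul_assoc]

end MatrixNorm

/-! ### Representations on finite equivalence classes -/

namespace EquivRel

open scoped Matrix.Norms.L2Operator

variable {X : Type u} [TopologicalSpace X] {s : Setoid X}

/-- `e` lists the elements of one equivalence class, without repetition. -/
structure IsClassList (s : Setoid X) {ι : Type*} (e : ι → X) : Prop where
  injective : Function.Injective e
  rel_iff : ∀ i y, s (e i) y ↔ y ∈ range e

variable {𝕜 : Type} [RCLike 𝕜] {ι : Type*} [Fintype ι] [DecidableEq ι] {e : ι → X}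

namespace IsClassList

theorem finsum_eq (he : IsClassList s e) {A : Type*} [AddCommMonoid A] (F : X → A) (i : ι)
    (hF : ∀ y, ¬ s (e i) y → F y = 0) : ∑ᶠ y, F y = ∑ j, F (e j) := by
  classical
  rw [finsum_eq_sum_of_support_subset (s := Finset.univ.image e) F,
    Finset.sum_image fun a _ b _ h => he.injective h]
  intro y hy
  have : s (e i) y := by
    by_contra h
    exact hy (hF y h)
  simpa using (he.rel_iff i y).1 this

variable [T2Space X] [IsEtale s]

/-- The restriction of the functions on the groupoid to one equivalence class. -/
def fiberMatrix (he : IsClassList s e) : ConvAlg 𝕜 s →⋆ₙₐ[𝕜] Matrix ι ι 𝕜 where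
  toFun f := Matrix.of fun i j => f.coef (e i) (e j)
  map_smul' c f := by ext i j; simp [ConvAlg.coef_smul]
  map_zero' := by ext i j; simp [ConvAlg.coef_zero]
  map_add' f g := by ext i j; simp [ConvAlg.coef_add]
  map_mul' f g := by
    ext i j
    simp only [Matrix.of_apply, Matrix.mul_apply, ConvAlg.coef_mul]
    exact he.finsum_eq _ i fun y hy => by rw [f.coef_of_not hy, zero_mul]
  map_star' f := by ext i j; simp [ConvAlg.coef_star, Matrix.star_apply]

theorem fiberMatrix_apply (he : IsClassList s e) (f : ConvAlg 𝕜 s) (i j : ι) :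
    he.fiberMatrix f i j = f.coef (e i) (e j) := rfl

theorem rowNorm_fiberMatrix_le (he : IsClassList s e) (f : ConvAlg 𝕜 s) :
    rowNorm (he.fiberMatrix f) ≤ f.iNorm := by
  have h0 : 0 ≤ f.iNorm := le_max_of_le_left
    (Real.iSup_nonneg fun x => finsum_nonneg fun y => norm_nonneg _)
  refine Real.iSup_le (fun i => ?_) h0
  refine le_trans (le_of_eq ?_) ((le_ciSup f.bddAbove_row (e i)).trans (le_max_left _ _))
  exact (he.finsum_eq (fun y => ‖f.coef (e i) y‖) i fun y hy => by
    rw [f.coef_of_not hy, norm_zero]).symm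

theorem iNorm_star (f : ConvAlg 𝕜 s) : (star f).iNorm = f.iNorm := by
  simp only [ConvAlg.iNorm, ConvAlg.coef_star, norm_star]
  exact max_comm _ _

/-- Schur's test: `‖A‖²` is at most the row norm of `A⋆ A`, hence at most the product of the row
norms of `A⋆` and `A`. Both are bounded by the `I`-norm, which is invariant under the involution. -/
theorem norm_fiberMatrix_le_iNorm (he : IsClassList s e) (f : ConvAlg 𝕜 s) :
    ‖he.fiberMatrix f‖ ≤ f.iNorm := by
  have h1 := he.rowNorm_fiberMatrix_le f
  have h2 := he.rowNorm_fiberMatrix_le (star f)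
  rw [iNorm_star, map_star] at h2
  have h0 := (rowNorm_nonneg (he.fiberMatrix f)).trans h1
  exact (mul_self_le_mul_self_iff (norm_nonneg _) h0).2
    ((norm_sq_le_of_le_mul he.fiberMatrix (fun f => rowNorm (he.fiberMatrix f))
      (fun f => rowNorm_nonneg _) (fun f g => by rw [map_mul]; exact rowNorm_mul _ _)
      (fun f => norm_le_card_mul_rowNorm _) f).trans
      (by
        rw [map_mul, map_star]
        exact (rowNorm_mul _ _).trans (mul_le_mul h2 h1 (rowNorm_nonneg _) h0)))

/-- The representation of the groupoid on the functions on an equivalence class. -/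
def rep {ι : Type u} [Fintype ι] [DecidableEq ι] {e : ι → X} (he : IsClassList s e) : Rep 𝕜 s where
  H := EuclideanSpace 𝕜 ι
  toHom :=
    { toFun := fun f => Matrix.toEuclideanCLM (𝕜 := 𝕜) (he.fiberMatrix f)
      map_smul' := fun c f => by rw [map_smul, map_smul]; rfl
      map_zero' := by rw [map_zero, map_zero]
      map_add' := fun f g => by rw [map_add, map_add]
      map_mul' := fun f g => by rw [map_mul, map_mul]
      map_star' := fun f => by rw [map_star, map_star] }
  norm_le f := he.norm_fiberMatrix_le_iNorm f

theorem norm_fiberMatrix_le_of_univ {ι : Type u} [Fintype ι] [DecidableEq ι] {e : ι → X}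
    (he : IsClassList s e) (f : ConvAlg 𝕜 s) : ‖he.fiberMatrix f‖ ≤ ‖universalRep 𝕜 s f‖ :=
  lp.norm_apply_le_norm (E := fun π : Rep 𝕜 s => π.H →L[𝕜] π.H) ENNReal.top_ne_zero
    (universalRep 𝕜 s f) he.rep

theorem norm_fiberMatrix_le (he : IsClassList s e) (f : ConvAlg 𝕜 s) :
    ‖he.fiberMatrix f‖ ≤ ‖universalRep 𝕜 s f‖ := by
  classical
  -- The Hilbert space of a `Rep` must lie in the universe of `X`, so the class is indexed by its
  -- own points instead of by `ι`.
  let c : ι ≃ range e := Equiv.ofInjective e he.injective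
  let _ : Fintype (range e) := Fintype.ofEquiv ι c
  have he' : IsClassList s (Subtype.val : range e → X) := by
    refine ⟨Subtype.val_injective, ?_⟩
    rintro ⟨_, i, rfl⟩ y
    simpa using he.rel_iff i y
  exact (norm_reindex_le c (he'.fiberMatrix f)).trans (he'.norm_fiberMatrix_le_of_univ f)

end IsClassList

variable [T2Space X] [IsEtale s]

/-- If the `I`-norm is bounded by a multiple of the norm of a `⋆`-homomorphism to a `C⋆`-ring,
then that norm dominates the full norm. -/
theorem norm_universalRep_le {T : Type*} [NonUnitalNormedRing T] [StarRing T] [CStarRing T]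
    [Module 𝕜 T] (θ : ConvAlg 𝕜 s →⋆ₙₐ[𝕜] T) {C : ℝ} (hC : ∀ f : ConvAlg 𝕜 s, f.iNorm ≤ C * ‖θ f‖)
    (f : ConvAlg 𝕜 s) : ‖universalRep 𝕜 s f‖ ≤ ‖θ f‖ :=
  lp.norm_le_of_forall_le (E := fun π : Rep 𝕜 s => π.H →L[𝕜] π.H)
    (f := universalRep 𝕜 s f) (norm_nonneg _) fun π =>
    norm_le_norm_of_le_mul π.toHom θ (fun f => (π.norm_le f).trans (hC f)) f

theorem CStarAlg.denseRange_ι : DenseRange (CStarAlg.ι 𝕜 s) := by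
  rintro ⟨a, ha⟩
  rw [closure_subtype]
  refine closure_mono ?_ ha
  rintro _ ⟨f, rfl⟩
  exact ⟨CStarAlg.ι 𝕜 s f, ⟨f, rfl⟩, rfl⟩

end EquivRel

/-! ### Density of the algebraic tensor product -/

section TensorDensity

open scoped Matrix.Norms.L2Operator

variable {𝕜 : Type} [RCLike 𝕜]

/-- A continuous function on `ℝ` that vanishes at infinity is uniformly approximated by finite sums
`∑ ρᵢ • G tᵢ` with compactly supported `ρᵢ`. -/
theorem exists_sum_smul_approx {V : Type*} [NormedAddCommGroup V] [NormedSpace 𝕜 V] (G : C(ℝ, V))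
    {ε : ℝ} (hε : 0 < ε) (hG : IsCompact {t | ε ≤ ‖G t‖}) :
    ∃ (T : Finset ℝ) (ρ : T → C(ℝ, ℝ)), (∀ i, HasCompactSupport (ρ i)) ∧
      ∀ x, ‖G x - ∑ i, (ρ i x : 𝕜) • G i‖ ≤ 2 * ε := by
  let U : ℝ → Set ℝ := fun t => {x | ‖G x - G t‖ < ε}
  have hU : ∀ t, IsOpen (U t) := fun t => isOpen_lt (by fun_prop) continuous_const
  obtain ⟨T, -, hT⟩ := hG.elim_nhds_subcover U fun t _ => (hU t).mem_nhds (by simpa [U] using hε)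
  obtain ⟨ρ, hρU, hρ⟩ := PartitionOfUnity.exists_isSubordinate_of_locallyFinite_t2space hG
    (fun i : T => U i) (fun i => hU i) (locallyFinite_of_finite _) (by simpa [iUnion_subtype] using hT)
  refine ⟨T, ρ, hρ, fun x => ?_⟩
  have h0 : ∀ i, 0 ≤ ρ i x := fun i => ρ.nonneg i x
  have h1 : ∑ i, ρ i x ≤ 1 := by simpa [finsum_eq_sum_of_fintype] using ρ.sum_le_one x
  -- The first summand is small because either the partition sums to `1` at `x` or `‖G x‖ < ε`. The
  -- second is small because `ρ i x ≠ 0` forces `G x` to be within `ε` of `G i`.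
  have e1 : G x - ∑ i, (ρ i x : 𝕜) • G i =
      ((1 - ∑ i, ρ i x : ℝ) : 𝕜) • G x + ∑ i, (ρ i x : 𝕜) • (G x - G i) := by
    simp only [smul_sub, Finset.sum_sub_distrib, ← Finset.sum_smul, RCLike.ofReal_sub,
      RCLike.ofReal_sum, sub_smul, RCLike.ofReal_one, one_smul]
    abel
  have e2 : ‖((1 - ∑ i, ρ i x : ℝ) : 𝕜) • G x‖ ≤ ε := by
    rw [norm_smul, RCLike.norm_ofReal, abs_of_nonneg (by linarith)]
    by_cases hx : ε ≤ ‖G x‖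
    · have := ρ.sum_eq_one hx
      rw [finsum_eq_sum_of_fintype] at this
      rw [this, sub_self, zero_mul]
      exact hε.le
    · have h3 : 0 ≤ ∑ i, ρ i x := Finset.sum_nonneg fun i _ => h0 i
      nlinarith [norm_nonneg (G x)]
  have e3 : ‖∑ i, (ρ i x : 𝕜) • (G x - G i)‖ ≤ ε := by
    refine (norm_sum_le_of_le _ (f := fun i => (ρ i x : 𝕜) • (G x - G i))
      (n := fun i => ρ i x * ε) fun i _ => ?_).trans ?_
    · rw [norm_smul, RCLike.norm_ofReal, abs_of_nonneg (h0 i)]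
      by_cases hi : ρ i x = 0
      · simp [hi]
      · exact mul_le_mul_of_nonneg_left (hρU i (subset_tsupport _ hi) : ‖G x - G i‖ < ε).le (h0 i)
    · rw [← Finset.sum_mul]
      nlinarith
  rw [e1]
  exact (norm_add_le _ _).trans (by linarith)

variable {k : ℕ} {B : Type v} [TopologicalSpace B] [CompactSpace B]

variable (𝕜 k B) in
/-- The span of the elementary tensors `f ⊗ g ⊗ a` for which `f` has compact support. -/
def compactTensor : Submodule 𝕜 C₀(ℝ × B, Matrix (Fin k) (Fin k) 𝕜) :=
  Submodule.span 𝕜 {x | ∃ (f : C₀(ℝ, 𝕜)) (g : C(B, 𝕜)) (a : Matrix (Fin k) (Fin k) 𝕜),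
    HasCompactSupport f ∧ x = elemTensor f g a}

theorem zeroAtInfty_sum_apply {ι α V : Type*} [TopologicalSpace α] [NormedAddCommGroup V]
    (t : Finset ι) (F : ι → C₀(α, V)) (z : α) : (∑ i ∈ t, F i) z = ∑ i ∈ t, F i z :=
  map_sum (⟨⟨fun F => F z, rfl⟩, fun _ _ => rfl⟩ : C₀(α, V) →+ V) F t

/-- The tensor `ρ ⊗ (b ↦ w b)`, for a scalar function `ρ` and a matrix-valued function `w`. -/
theorem exists_mem_compactTensor (ρ : C(ℝ, ℝ)) (hρ : HasCompactSupport ρ)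
    (w : C(B, Matrix (Fin k) (Fin k) 𝕜)) :
    ∃ x ∈ compactTensor 𝕜 k B, ∀ z, x z = (ρ z.1 : 𝕜) • w z.2 := by
  have hf : HasCompactSupport fun t => (ρ t : 𝕜) := hρ.comp_left (by simp)
  let f : C₀(ℝ, 𝕜) := ⟨⟨fun t => (ρ t : 𝕜), by fun_prop⟩, hf.is_zero_at_infty⟩
  refine ⟨∑ i, ∑ j, elemTensor f (⟨fun b => w b i j, w.continuous.matrix_elem i j⟩ : C(B, 𝕜)) (Matrix.single i j 1),
    sum_mem fun i _ => sum_mem fun j _ => Submodule.subset_span ⟨f, _, _, hf, rfl⟩, fun z => ?_⟩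
  rw [Matrix.matrix_eq_sum_single ((ρ z.1 : 𝕜) • w z.2)]
  simp only [zeroAtInfty_sum_apply, elemTensor_apply]
  refine Finset.sum_congr rfl fun i _ => Finset.sum_congr rfl fun j _ => ?_
  rw [Matrix.smul_single, Matrix.smul_apply]
  simp [f]

/-- Currying turns `F` into a function on `ℝ` with values in `C(B, M_k)`, to which the partition of
unity applies. Each value is split into matrix units, so no approximation in the variable `b` is
needed. -/
theorem mem_closure_compactTensor (F : C₀(ℝ × B, Matrix (Fin k) (Fin k) 𝕜)) :
    F ∈ closure (compactTensor 𝕜 k B : Set C₀(ℝ × B, Matrix (Fin k) (Fin k) 𝕜)) := by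
  rw [Metric.mem_closure_iff]
  intro ε hε
  let G : C(ℝ, C(B, Matrix (Fin k) (Fin k) 𝕜)) := (F : C(ℝ × B, _)).curry
  have hGF : ∀ t b, G t b = F (t, b) := fun _ _ => rfl
  have hK : IsCompact {z | ε / 3 ≤ ‖F z‖} := by
    have h1 := (zero_at_infty F).norm.eventually_lt_const (u := ε / 3) (by simp; positivity)
    obtain ⟨K, hK, hKF⟩ := mem_cocompact.1 h1
    refine hK.of_isClosed_subset (isClosed_le continuous_const (by fun_prop)) fun z hz => ?_
    by_contra h
    exact absurd (show ‖F z‖ < ε / 3 from hKF h) (not_lt.2 hz)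
  -- As `B` is compact, a strict pointwise bound on `B` gives a strict bound on the sup norm; hence
  -- this set lies in the projection of the compact set in `hK`.
  have hG : IsCompact {t | ε / 3 ≤ ‖G t‖} := by
    refine (hK.image continuous_fst).of_isClosed_subset
      (isClosed_le continuous_const (by fun_prop)) fun t ht => ?_
    by_contra h
    refine absurd ((ContinuousMap.norm_lt_iff _ (by positivity : 0 < ε / 3)).2 fun b => ?_)
      (not_lt.2 ht)
    by_contra hb
    exact h ⟨(t, b), not_lt.1 hb, rfl⟩
  obtain ⟨T, ρ, hρ, hT⟩ := exists_sum_smul_approx (𝕜 := 𝕜) G (by positivity) hG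
  choose x hx hx' using fun i : T => exists_mem_compactTensor (ρ i) (hρ i) (G i)
  refine ⟨∑ i, x i, sum_mem fun i _ => hx i, ?_⟩
  rw [dist_eq_norm, ← ZeroAtInftyContinuousMap.norm_toBCF_eq_norm]
  refine lt_of_le_of_lt ((BoundedContinuousFunction.norm_le (by positivity)).2 fun z => ?_)
    (by linarith : 2 * (ε / 3) < ε)
  refine le_trans (le_of_eq ?_) ((ContinuousMap.norm_coe_le_norm _ z.2).trans (hT z.1))
  simp [hx', hGF, zeroAtInfty_sum_apply]

/-- Hence the C⋆-tensor product is all of `C₀(ℝ × B, M_k)`, and a kernel element only has to be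
recognised as a matrix function vanishing at infinity. -/
theorem mem_cstarTensor (F : C₀(ℝ × B, Matrix (Fin k) (Fin k) 𝕜)) : F ∈ cstarTensor 𝕜 k B := by
  refine closure_mono ?_ (mem_closure_compactTensor F)
  change compactTensor 𝕜 k B ≤ LinearMap.range (tensorMap 𝕜 k B)
  rw [range_tensorMap]
  refine Submodule.span_mono ?_
  rintro _ ⟨f, g, a, -, rfl⟩
  exact ⟨f, g, a, rfl⟩

end TensorDensity

/-! ### Functions supported on the units -/

namespace EquivRel

variable {X : Type u} [TopologicalSpace X] {s : Setoid X}

/-- The units are open because the range map is locally injective: an arrow near a unit and the unit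
at its range lie in one chart and have the same range, so they agree. -/
theorem isClopen_diagonal [T2Space X] [hs : IsEtale s] :
    IsClopen {γ : Graph s | γ.1.1 = γ.1.2} := by
  refine ⟨isClosed_eq (by fun_prop) (by fun_prop), isOpen_iff_mem_nhds.2 fun γ hγ => ?_⟩
  obtain ⟨e, he, hee⟩ := hs.isLocalHomeomorph γ
  let unit : Graph s → Graph s := fun γ => ⟨(γ.1.1, γ.1.1), s.refl' _⟩
  have hu : Continuous unit := by fun_prop
  have huγ : unit γ = γ := Subtype.ext (Prod.ext rfl hγ)
  filter_upwards [e.open_source.mem_nhds he,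
    (e.open_source.preimage hu).mem_nhds (show unit γ ∈ e.source by rwa [huγ])] with δ h1 h2
  have h3 : unit δ = δ := e.injOn h2 h1 (by rw [← hee])
  exact congrArg (fun γ : Graph s => γ.1.2) h3

variable {𝕜 : Type} [RCLike 𝕜]

/-- A compactly supported function on the unit space, as a function on the groupoid. -/
def diagCc [T2Space X] [IsEtale s] (u : C_c(X, 𝕜)) : ConvAlg 𝕜 s :=
  (⟨⟨{γ : Graph s | γ.1.1 = γ.1.2}.indicator fun γ => u γ.1.1,
    Continuous.indicator (by simp [isClopen_diagonal.frontier_eq]) (by fun_prop)⟩,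
    HasCompactSupport.intro
      (u.hasCompactSupport.isCompact.image (f := fun x => (⟨(x, x), s.refl' x⟩ : Graph s))
        (by fun_prop)) fun γ hγ => by
      by_contra h
      have h1 : γ ∈ {γ : Graph s | γ.1.1 = γ.1.2} := mem_of_indicator_ne_zero (f := fun γ : Graph s => u γ.1.1) h
      replace h : u γ.1.1 ≠ 0 := fun h0 => h ((indicator_of_mem h1 fun γ : Graph s => u γ.1.1).trans h0)
      exact hγ ⟨γ.1.1, subset_tsupport _ h, Subtype.ext (Prod.ext rfl h1)⟩⟩ : C_c(Graph s, 𝕜))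

theorem coef_diagCc_self [T2Space X] [IsEtale s] (u : C_c(X, 𝕜)) (x : X) :
    (diagCc u : ConvAlg 𝕜 s).coef x x = u x := by
  rw [show (diagCc u : ConvAlg 𝕜 s).coef x x = _ from ConvAlg.coef_graph _ ⟨(x, x), s.refl' x⟩]
  exact indicator_of_mem (s := {γ : Graph s | γ.1.1 = γ.1.2}) (a := ⟨(x, x), s.refl' x⟩)
    (by exact rfl) fun γ => u γ.1.1

theorem coef_diagCc_of_ne [T2Space X] [IsEtale s] (u : C_c(X, 𝕜)) {x y : X} (h : x ≠ y) :
    (diagCc u : ConvAlg 𝕜 s).coef x y = 0 := by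
  by_cases hs : s x y
  · rw [show (diagCc u : ConvAlg 𝕜 s).coef x y = _ from ConvAlg.coef_graph _ ⟨(x, y), hs⟩]
    exact indicator_of_notMem (s := {γ : Graph s | γ.1.1 = γ.1.2}) (a := ⟨(x, y), hs⟩) h
      fun γ => u γ.1.1
  · exact ConvAlg.coef_of_not _ hs

end EquivRel

/-! ### Equivalence classes and coordinates on the open cylinders -/

namespace AttachCylinder

open EquivRel

variable {X : Type u} [TopologicalSpace X] {S : Set X} {B : Type v} [TopologicalSpace B] {k : ℕ}
  {p : S → B}

theorem exists_cyl (a : AttachCylinder S) (h : 0 < (toProd a).2) :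
    ∃ x : S, a = cyl (x, (toProd a).2) := by
  rw [← Set.mem_ofPred (p := fun a : AttachCylinder S => 0 < (toProd a).2), ← range_cyl_pos] at h
  obtain ⟨q, -, rfl⟩ := h
  exact ⟨q.1, rfl⟩

theorem toProd_mem {a : AttachCylinder S} (h : 0 < (toProd a).2) : (toProd a).1 ∈ S := by
  obtain ⟨x, hx⟩ := exists_cyl a h
  rw [hx]
  exact x.2

theorem cyl_toProd {a : AttachCylinder S} (h : 0 < (toProd a).2) :
    cyl (⟨(toProd a).1, toProd_mem h⟩, (toProd a).2) = a :=
  injective_toProd rfl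

theorem eq_base_of_toProd {a : AttachCylinder S} (h : (toProd a).2 = 0) :
    a = base (toProd a).1 :=
  injective_toProd (Prod.ext rfl h)

theorem toProd_snd_eq {a b : AttachCylinder S} (h : cylinderSetoid p a b) :
    (toProd a).2 = (toProd b).2 := by
  rcases h with rfl | ⟨x, y, t, ht, rfl, rfl, h⟩
  · rfl
  · rfl

theorem eq_of_rel_base {x : X} {b : AttachCylinder S}
    (h : cylinderSetoid p (base x) b) : base x = b := by
  rcases h with h | ⟨x', y, t, ht, h, -, -⟩
  · exact h
  · exact absurd (congrArg (fun a => (toProd a).2) h) ht.ne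

theorem isClassList_base (x : X) :
    IsClassList (cylinderSetoid p) (fun _ : Unit => (base x : AttachCylinder S)) where
  injective _ _ _ := rfl
  rel_iff _ y := by
    refine ⟨fun h => ⟨(), eq_of_rel_base h⟩, ?_⟩
    rintro ⟨_, rfl⟩
    exact Setoid.refl' _ _

variable (ψ : S ≃ₜ B × Fin k)

/-- The point of the `i`-th cylinder over `b ∈ B` at the height `exp t`. -/
def pt (z : ℝ × B) (i : Fin k) : AttachCylinder S :=
  cyl (ψ.symm (z.2, i), ⟨Real.exp z.1, (Real.exp_pos _).le⟩)

theorem continuous_pt (i : Fin k) : Continuous fun z => pt ψ z i :=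
  continuous_cyl.comp (by fun_prop)

theorem toProd_pt_pos (z : ℝ × B) (i : Fin k) : 0 < (toProd (pt ψ z i)).2 := Real.exp_pos z.1

/-- The coordinates of a point of the open cylinders. -/
def cylCoord (a : {a : AttachCylinder S // 0 < (toProd a).2}) : (ℝ × B) × Fin k :=
  ((Real.log (toProd a.1).2, (ψ ⟨_, toProd_mem a.2⟩).1), (ψ ⟨_, toProd_mem a.2⟩).2)

theorem continuous_cylCoord (hS : IsClosed S) [T2Space X] : Continuous (cylCoord ψ) := by
  have h := (isClosedEmbedding_toProd hS).continuous
  have h1 : Continuous fun a : {a : AttachCylinder S // 0 < (toProd a).2} =>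
      Real.log (toProd a.1).2 := Continuous.log (by fun_prop) fun a => ne_of_gt a.2
  unfold cylCoord
  fun_prop

theorem pt_cylCoord (a : {a : AttachCylinder S // 0 < (toProd a).2}) :
    pt ψ (cylCoord ψ a).1 (cylCoord ψ a).2 = a.1 := by
  refine Eq.trans ?_ (cyl_toProd a.2)
  exact congrArg cyl (Prod.ext (by simp [cylCoord]) (Subtype.ext (Real.exp_log a.2)))

theorem cylCoord_pt (z : ℝ × B) (i : Fin k) :
    cylCoord ψ ⟨pt ψ z i, toProd_pt_pos ψ z i⟩ = (z, i) := by
  refine Prod.ext (Prod.ext (Real.log_exp _) ?_) ?_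
  · change (ψ (ψ.symm (z.2, i))).1 = z.2
    rw [ψ.apply_symm_apply]
  · change (ψ (ψ.symm (z.2, i))).2 = i
    rw [ψ.apply_symm_apply]

variable {ψ} (hp : ∀ x, p x = (ψ x).1)

include hp

theorem rel_pt (z : ℝ × B) (i j : Fin k) : cylinderSetoid p (pt ψ z i) (pt ψ z j) :=
  .inr ⟨_, _, _, Real.exp_pos z.1, rfl, rfl, by simp [hp]⟩

theorem isClassList_pt (z : ℝ × B) : IsClassList (cylinderSetoid p) (pt ψ z) where
  injective i j h := by
    have := (Prod.ext_iff.1 (cyl_injective h)).1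
    exact (Prod.ext_iff.1 (ψ.symm.injective this)).2
  rel_iff i y := by
    constructor
    · rintro (rfl | ⟨x, y, t, ht, h, rfl, hxy⟩)
      · exact ⟨i, rfl⟩
      · obtain ⟨rfl, rfl⟩ := Prod.ext_iff.1 (cyl_injective h)
        refine ⟨(ψ y).2, congrArg cyl (Prod.ext ?_ rfl)⟩
        rw [hp, hp, ψ.apply_symm_apply] at hxy
        exact (ψ.symm_apply_eq).2 (Prod.ext hxy rfl)
    · rintro ⟨j, rfl⟩
      exact rel_pt hp z i j

/-- Equivalent points differ only in the sheet. So the groupoid over the open cylinders is the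
product of `ℝ × B` with the pair groupoid of `Fin k`. -/
theorem fst_cylCoord_eq {a b : {a : AttachCylinder S // 0 < (toProd a).2}}
    (h : cylinderSetoid p a.1 b.1) : (cylCoord ψ a).1 = (cylCoord ψ b).1 := by
  obtain ⟨⟨a, ha⟩, b, hb⟩ := a, b
  rcases h with rfl | ⟨x, y, t, ht, rfl, rfl, h⟩
  · rfl
  · rw [hp, hp] at h
    exact Prod.ext rfl h

end AttachCylinder

/-! ### The faithful representation by matrix functions -/

namespace AttachCylinder

open EquivRel
open scoped Matrix.Norms.L2Operator BoundedContinuousFunction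

variable {X : Type u} [TopologicalSpace X] {S : Set X} {B : Type v} [TopologicalSpace B] {k : ℕ}
  {p : S → B} {ψ : S ≃ₜ B × Fin k} (hp : ∀ x, p x = (ψ x).1) {𝕜 : Type} [RCLike 𝕜]

section

variable [T2Space (AttachCylinder S)] [IsEtale (cylinderSetoid p)]

/-- The family of the matrices of a function on the groupoid over the points of the open cylinder. -/
def cylinderRep : ConvAlg 𝕜 (cylinderSetoid p) →⋆ₙₐ[𝕜] (ℝ × B) →ᵇ Matrix (Fin k) (Fin k) 𝕜 where
  toFun f := BoundedContinuousFunction.ofNormedAddCommGroup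
    (fun z => (isClassList_pt hp z).fiberMatrix f)
    (continuous_matrix fun i j => f.continuousOn_coef.comp_continuous
      ((continuous_pt ψ i).prodMk (continuous_pt ψ j)) fun z => rel_pt hp z i j)
    f.iNorm fun z => (isClassList_pt hp z).norm_fiberMatrix_le_iNorm f
  map_smul' c f := BoundedContinuousFunction.ext fun z => map_smul (isClassList_pt hp z).fiberMatrix c f
  map_zero' := BoundedContinuousFunction.ext fun z => map_zero (isClassList_pt hp z).fiberMatrix
  map_add' f g := BoundedContinuousFunction.ext fun z =>
    map_add (isClassList_pt hp z).fiberMatrix f g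
  map_mul' f g := BoundedContinuousFunction.ext fun z =>
    map_mul (isClassList_pt hp z).fiberMatrix f g
  map_star' f := BoundedContinuousFunction.ext fun z =>
    map_star (isClassList_pt hp z).fiberMatrix f

theorem cylinderRep_apply (f : ConvAlg 𝕜 (cylinderSetoid p)) (z : ℝ × B) :
    cylinderRep hp f z = (isClassList_pt hp z).fiberMatrix f := rfl

/-- The restriction of a function on the groupoid to the units in `X`. -/
def baseRep : ConvAlg 𝕜 (cylinderSetoid p) →⋆ₙₐ[𝕜] C(X, 𝕜) where
  toFun f := ⟨fun x => f.coef (base x) (base x), f.continuousOn_coef.comp_continuous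
    (continuous_base.prodMk continuous_base) fun x => (cylinderSetoid p).refl' (base x)⟩
  map_smul' c f := ContinuousMap.ext fun x => f.coef_smul c _ _
  map_zero' := ContinuousMap.ext fun x => ConvAlg.coef_zero _ _
  map_add' f g := ContinuousMap.ext fun x => f.coef_add g _ _
  map_mul' f g := ContinuousMap.ext fun x => by
    -- A point of `X` is alone in its class, so convolution there is multiplication of `1 × 1`
    -- matrices.
    have := congrFun (congrFun (map_mul (isClassList_base x).fiberMatrix f g) ()) ()
    simpa [Matrix.mul_apply, IsClassList.fiberMatrix_apply] using this
  map_star' f := ContinuousMap.ext fun x => f.coef_star _ _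

theorem baseRep_apply (f : ConvAlg 𝕜 (cylinderSetoid p)) (x : X) :
    baseRep f x = f.coef (base x) (base x) := rfl

variable [CompactSpace X]

/-- The restriction to the open cylinder and to the units in `X`. -/
def totalRep : ConvAlg 𝕜 (cylinderSetoid p) →⋆ₙₐ[𝕜]
    ((ℝ × B) →ᵇ Matrix (Fin k) (Fin k) 𝕜) × C(X, 𝕜) :=
  (cylinderRep hp).prod baseRep

theorem totalRep_apply (f : ConvAlg 𝕜 (cylinderSetoid p)) :
    totalRep hp f = (cylinderRep hp f, baseRep f) := rfl

/-- A row has one entry over `X` and `k` entries over the open cylinders, each bounded by `‖totalRep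
hp f‖`. The factor `k + 1` covers both cases. -/
theorem row_le_norm_totalRep (f : ConvAlg 𝕜 (cylinderSetoid p)) (a : AttachCylinder S) :
    ∑ᶠ b, ‖f.coef a b‖ ≤ (k + 1) * ‖totalRep hp f‖ := by
  have h0 : 0 ≤ ‖totalRep hp f‖ := norm_nonneg _
  rcases eq_zero_or_pos (toProd a).2 with ha | ha
  · rw [eq_base_of_toProd ha, (isClassList_base (p := p) _).finsum_eq _ () fun y hy => by
      rw [f.coef_of_not hy, norm_zero]]
    have h1 : ‖baseRep f (toProd a).1‖ ≤ ‖totalRep hp f‖ :=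
      ((baseRep f).norm_coe_le_norm _).trans (norm_snd_le (totalRep hp f))
    have h2 : (0 : ℝ) ≤ k := Nat.cast_nonneg k
    rw [baseRep_apply] at h1
    simp only [Finset.univ_unique, Finset.sum_singleton]
    nlinarith
  · obtain ⟨z, i, rfl⟩ : ∃ z i, pt ψ z i = a := ⟨_, _, pt_cylCoord ψ ⟨a, ha⟩⟩
    rw [(isClassList_pt hp z).finsum_eq _ i fun y hy => by rw [f.coef_of_not hy, norm_zero]]
    have h1 : ∀ j, ‖f.coef (pt ψ z i) (pt ψ z j)‖ ≤ ‖totalRep hp f‖ := fun j =>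
      (norm_entry_le_l2 (cylinderRep hp f z) i j).trans
        (((cylinderRep hp f).norm_coe_le_norm z).trans (norm_fst_le (totalRep hp f)))
    refine (Finset.sum_le_card_nsmul _ _ _ fun j _ => h1 j).trans ?_
    simp only [Finset.card_univ, Fintype.card_fin, nsmul_eq_mul]
    nlinarith

theorem iNorm_le_norm_totalRep (f : ConvAlg 𝕜 (cylinderSetoid p)) :
    f.iNorm ≤ (k + 1) * ‖totalRep hp f‖ := by
  have h0 : 0 ≤ (k + 1) * ‖totalRep hp f‖ := by positivity
  refine max_le (Real.iSup_le (row_le_norm_totalRep hp f) h0) (Real.iSup_le (fun b => ?_) h0)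
  have h := row_le_norm_totalRep hp (star f) b
  rw [map_star, norm_star] at h
  simpa only [ConvAlg.coef_star, norm_star] using h

/-- For `≤`, the components come from class representations, which occur in the supremum defining
the full norm. For `≥`, the bound on the `I`-norm controls every representation. -/
theorem norm_totalRep (f : ConvAlg 𝕜 (cylinderSetoid p)) :
    ‖totalRep hp f‖ = ‖CStarAlg.ι 𝕜 (cylinderSetoid p) f‖ := by
  have h : ‖universalRep 𝕜 (cylinderSetoid p) f‖ ≤ ‖totalRep hp f‖ :=
    have := norm_universalRep_le (𝕜 := 𝕜) (totalRep hp) (C := (k : ℝ) + 1)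
    this (iNorm_le_norm_totalRep hp) f
  refine le_antisymm (max_le ?_ ?_) h
  · exact (BoundedContinuousFunction.norm_le (norm_nonneg _)).2 fun z =>
      (isClassList_pt hp z).norm_fiberMatrix_le f
  · exact (ContinuousMap.norm_le _ (norm_nonneg _)).2 fun x =>
      (norm_entry_le_l2 ((isClassList_base x).fiberMatrix f) () ()).trans
        ((isClassList_base x).norm_fiberMatrix_le f)

end

/-! ### The image of the convolution algebra -/

section Image

variable [T2Space X] [T2Space (AttachCylinder S)] [IsEtale (cylinderSetoid p)] (hS : IsClosed S)

include hS

/-- The matrix function of a function on the groupoid that vanishes on the units in `X` vanishes at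
infinity. -/
theorem cylinderRep_mem_range [CompactSpace B] (f : ConvAlg 𝕜 (cylinderSetoid p))
    (hf : ∀ x, f.coef (base x) (base x) = 0) :
    cylinderRep hp f ∈ range (ZeroAtInftyContinuousMap.toBCF :
      C₀(ℝ × B, Matrix (Fin k) (Fin k) 𝕜) → _) := by
  have hP := (isClosedEmbedding_toProd hS).continuous
  have key : Tendsto (cylinderRep hp f) (cocompact (ℝ × B)) (𝓝 0) := by
    refine tendsto_pi_nhds.2 fun i => tendsto_pi_nhds.2 fun j => ?_
    refine Metric.tendsto_nhds.2 fun ε hε => ?_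
    set K := {γ : Graph (cylinderSetoid p) | ε ≤ ‖f.toCc γ‖}
    have hK : IsCompact K := by
      refine f.toCc.hasCompactSupport.isCompact.of_isClosed_subset
        (isClosed_le continuous_const (by fun_prop)) fun γ hγ => subset_tsupport _ fun h => ?_
      have hγ : ε ≤ ‖f.toCc γ‖ := hγ
      rw [h, norm_zero] at hγ
      exact hγ.not_gt hε
    -- At height `0` the only arrows are units, where `f` vanishes.
    have hpos : ∀ γ ∈ K, 0 < (toProd γ.1.1).2 := by
      rintro γ (hγ : ε ≤ ‖f.toCc γ‖)
      by_contra h0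
      have ha := eq_base_of_toProd (not_lt.1 h0 |>.antisymm zero_le)
      have hab := γ.2
      rw [← f.coef_graph] at hγ
      rw [ha] at hab hγ
      rw [← eq_of_rel_base hab, hf, norm_zero] at hγ
      exact hγ.not_gt hε
    -- Compactness of `K` bounds the heights above and, since they are positive on `K`, away from
    -- `0`. Thus `t = log (height)` stays in a compact subset of `ℝ`.
    have hL : IsCompact ((fun γ : Graph (cylinderSetoid p) => Real.log (toProd γ.1.1).2) '' K) :=
      hK.image_of_continuousOn (ContinuousOn.log (by fun_prop) fun γ hγ => ne_of_gt (hpos γ hγ))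
    refine mem_cocompact.2 ⟨_, hL.prod isCompact_univ, fun z hz => ?_⟩
    by_contra h
    have h1 : ε ≤ ‖f.coef (pt ψ z i) (pt ψ z j)‖ := by
      simpa [cylinderRep_apply, IsClassList.fiberMatrix_apply] using h
    refine hz ⟨⟨⟨(pt ψ z i, pt ψ z j), rel_pt hp z i j⟩, ?_, Real.log_exp _⟩, mem_univ _⟩
    rwa [ConvAlg.coef_graph f ⟨(pt ψ z i, pt ψ z j), rel_pt hp z i j⟩] at h1
  exact ⟨⟨(cylinderRep hp f).toContinuousMap, key⟩, rfl⟩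

/-- The arrows of positive height form an open subset of the groupoid, homeomorphic to `(ℝ × B) ×
(Fin k × Fin k)`. The entries of `F` are a compactly supported function there, and extension by zero
keeps it continuous and vanishing on `X`. -/
theorem exists_totalRep_eq [CompactSpace X] (F : C₀(ℝ × B, Matrix (Fin k) (Fin k) 𝕜))
    (hF : HasCompactSupport F) :
    ∃ f : ConvAlg 𝕜 (cylinderSetoid p), totalRep hp f = (F.toBCF, 0) := by
  have hP := (isClosedEmbedding_toProd hS).continuous
  let U : Set (Graph (cylinderSetoid p)) := {γ | 0 < (toProd γ.1.1).2}
  have hU : IsOpen U := isOpen_lt continuous_const (by fun_prop)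
  let l : U → {a : AttachCylinder S // 0 < (toProd a).2} := fun γ => ⟨γ.1.1.1, γ.2⟩
  let r : U → {a : AttachCylinder S // 0 < (toProd a).2} := fun γ =>
    ⟨γ.1.1.2, toProd_snd_eq γ.1.2 ▸ γ.2⟩
  have hl : Continuous l := by fun_prop
  have hr : Continuous r := by fun_prop
  have hlr : ∀ γ, (cylCoord ψ (l γ)).1 = (cylCoord ψ (r γ)).1 := fun γ => fst_cylCoord_eq hp γ.1.2
  let c : U → (ℝ × B) × (Fin k × Fin k) := fun γ =>
    ((cylCoord ψ (l γ)).1, (cylCoord ψ (l γ)).2, (cylCoord ψ (r γ)).2)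
  have hcc := continuous_cylCoord ψ hS
  have hc : Continuous c := (hcc.comp hl).fst.prodMk ((hcc.comp hl).snd.prodMk (hcc.comp hr).snd)
  -- `Q` is the inverse of the chart `c`. Its continuity transports the compact support of `F` to
  -- the groupoid.
  let Q : (ℝ × B) × (Fin k × Fin k) → U := fun w =>
    ⟨⟨(pt ψ w.1 w.2.1, pt ψ w.1 w.2.2), rel_pt hp _ _ _⟩, toProd_pt_pos ψ _ _⟩
  have hQ : Continuous Q := by
    have h1 : Continuous fun w : (ℝ × B) × Fin k => pt ψ w.1 w.2 :=
      continuous_prod_of_discrete_right.2 fun i => continuous_pt ψ i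
    have h2 : Continuous fun w : (ℝ × B) × (Fin k × Fin k) => pt ψ w.1 w.2.1 :=
      h1.comp (by fun_prop : Continuous fun w : (ℝ × B) × (Fin k × Fin k) => (w.1, w.2.1))
    have h3 : Continuous fun w : (ℝ × B) × (Fin k × Fin k) => pt ψ w.1 w.2.2 :=
      h1.comp (by fun_prop : Continuous fun w : (ℝ × B) × (Fin k × Fin k) => (w.1, w.2.2))
    fun_prop
  have hQc : ∀ γ, Q (c γ) = γ := fun γ => Subtype.ext (Subtype.ext (Prod.ext (pt_cylCoord ψ (l γ))
    ((congrArg (fun z => pt ψ z _) (hlr γ)).trans (pt_cylCoord ψ (r γ)))))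
  have hcQ : ∀ w, c (Q w) = w := fun w => by
    have h1 : cylCoord ψ (l (Q w)) = (w.1, w.2.1) := cylCoord_pt ψ w.1 w.2.1
    have h2 : cylCoord ψ (r (Q w)) = (w.1, w.2.2) := cylCoord_pt ψ w.1 w.2.2
    simp only [c, h1, h2]
  let f₀ : U → 𝕜 := fun γ => F (c γ).1 (c γ).2.1 (c γ).2.2
  have hf₀ : Continuous f₀ := by
    have h1 : Continuous fun w : (ℝ × B) × (Fin k × Fin k) => F w.1 w.2.1 w.2.2 :=
      continuous_prod_of_discrete_right.2 fun ij => (map_continuous F).matrix_elem ij.1 ij.2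
    exact h1.comp hc
  have hs : HasCompactSupport f₀ := by
    refine HasCompactSupport.intro ((hF.isCompact.prod isCompact_univ).image hQ) fun γ hγ => ?_
    by_contra h
    refine hγ ⟨c γ, ⟨subset_tsupport _ fun h0 => h ?_, mem_univ _⟩, hQc γ⟩
    simp [f₀, h0]
  let f : ConvAlg 𝕜 (cylinderSetoid p) := (⟨⟨Subtype.val.extend f₀ 0,
    hs.continuous_extend_zero hU hf₀⟩, hs.extend_zero continuous_subtype_val⟩ :
      C_c(Graph (cylinderSetoid p), 𝕜))
  refine ⟨f, Prod.ext ?_ ?_⟩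
  · ext z i j
    refine (ConvAlg.coef_graph f (Q (z, i, j)).1).trans ?_
    refine (Subtype.val_injective.extend_apply f₀ 0 (Q (z, i, j))).trans ?_
    simp only [f₀, hcQ]
    rfl
  · ext x
    refine (ConvAlg.coef_graph f ⟨(base x, base x), Setoid.refl' _ _⟩).trans ?_
    refine (Function.extend_apply' f₀ (0 : Graph (cylinderSetoid p) → 𝕜) _ ?_).trans rfl
    rintro ⟨⟨γ, hγ⟩, rfl⟩
    exact lt_irrefl (0 : ℝ≥0) hγ

/-- Extend `g` along the cylinders by the cutoff `max 0 (1 - t)` and place it on the units. Its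
matrices are diagonal with entries bounded by `‖g‖`; this norm control is what the proof of
exactness needs. -/
theorem exists_baseRep_eq [CompactSpace X] (g : C(X, 𝕜)) :
    ∃ f : ConvAlg 𝕜 (cylinderSetoid p), baseRep f = g ∧ ‖totalRep hp f‖ ≤ ‖g‖ := by
  have hP := isClosedEmbedding_toProd hS
  have hPc := hP.continuous
  let u : C_c(AttachCylinder S, 𝕜) :=
    ⟨⟨fun a => g (toProd a).1 * ((max 0 (1 - ((toProd a).2 : ℝ)) : ℝ) : 𝕜), by fun_prop⟩, by
      refine HasCompactSupport.intro (hP.isCompact_preimage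
        (isCompact_univ.prod (isCompact_Icc (a := 0) (b := 1)))) fun a ha => ?_
      have h1 : 1 < (toProd a).2 := by
        by_contra h
        exact ha ⟨mem_univ _, zero_le, not_lt.1 h⟩
      have h2 : (1 : ℝ) < (toProd a).2 := h1
      simp [max_eq_left (by linarith : 1 - ((toProd a).2 : ℝ) ≤ 0)]⟩
  have hu : ∀ a, u a = g (toProd a).1 * ((max 0 (1 - ((toProd a).2 : ℝ)) : ℝ) : 𝕜) := fun _ => rfl
  have hub : ∀ a, ‖u a‖ ≤ ‖g‖ := fun a => by
    rw [hu, norm_mul, RCLike.norm_ofReal, abs_of_nonneg (le_max_left _ _)]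
    refine (mul_le_of_le_one_right (norm_nonneg _) (max_le zero_le_one ?_)).trans
      (g.norm_coe_le_norm _)
    simp
  have hbase : baseRep (diagCc u : ConvAlg 𝕜 (cylinderSetoid p)) = g := by
    ext x
    rw [baseRep_apply, coef_diagCc_self, hu, toProd_base]
    simp
  refine ⟨diagCc u, hbase, max_le ?_ ?_⟩
  · refine (BoundedContinuousFunction.norm_le (norm_nonneg _)).2 fun z => ?_
    have h1 : cylinderRep hp (diagCc u) z = Matrix.diagonal fun i => u (pt ψ z i) := by
      ext i j
      rw [cylinderRep_apply, IsClassList.fiberMatrix_apply]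
      by_cases hij : i = j
      · subst hij
        rw [coef_diagCc_self, Matrix.diagonal_apply_eq]
      · rw [coef_diagCc_of_ne _ fun h => hij ((isClassList_pt hp z).injective h),
          Matrix.diagonal_apply_ne _ hij]
    refine (congrArg norm h1).trans_le ?_
    rw [Matrix.l2_opNorm_diagonal, pi_norm_le_iff_of_nonneg (norm_nonneg _)]
    exact fun i => hub _
  · exact (congrArg norm hbase).le

end Image

/-! ### The exact sequence -/

section Main

variable [CompactSpace X] [T2Space X] [CompactSpace B] [T2Space B]

theorem hasCompactSupport_elemTensor {f : C₀(ℝ, 𝕜)} (hf : HasCompactSupport f) (g : C(B, 𝕜))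
    (a : Matrix (Fin k) (Fin k) 𝕜) : HasCompactSupport (elemTensor f g a) := by
  refine HasCompactSupport.intro (hf.isCompact.prod isCompact_univ) fun z hz => ?_
  have : f z.1 = 0 := by
    by_contra h
    exact hz ⟨subset_tsupport _ h, mem_univ _⟩
  simp [elemTensor_apply, this]

include hp in
theorem exists_exact_sequence [T2Space (AttachCylinder S)] [IsEtale (cylinderSetoid p)]
    (hS : IsClosed S) :
    ∃ (i : cstarTensor 𝕜 k B →⋆ₙₐ[𝕜] CStarAlg 𝕜 (cylinderSetoid p))
      (q : CStarAlg 𝕜 (cylinderSetoid p) →⋆ₙₐ[𝕜] C(X, 𝕜)),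
      Function.Injective i ∧ Function.Exact i q ∧ Function.Surjective q ∧
      ∀ (f : ConvAlg 𝕜 (cylinderSetoid p)) (x : X),
        q (CStarAlg.ι 𝕜 (cylinderSetoid p) f) x = f.coef (base x) (base x) := by
  obtain ⟨Θ, hΘ, hn⟩ := exists_isometric_extension (CStarAlg.ι 𝕜 (cylinderSetoid p))
    CStarAlg.denseRange_ι (totalRep hp) (norm_totalRep hp)
  have hiso : Isometry Θ := AddMonoidHomClass.isometry_of_norm Θ hn
  let j : cstarTensor 𝕜 k B →⋆ₙₐ[𝕜] ((ℝ × B) →ᵇ Matrix (Fin k) (Fin k) 𝕜) × C(X, 𝕜) :=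
    { toFun := fun F => (F.1.toBCF, 0)
      map_smul' := fun c F => by ext <;> simp
      map_zero' := rfl
      map_add' := fun F G => by ext <;> simp
      map_mul' := fun F G => by ext <;> simp
      map_star' := fun F => by ext <;> simp }
  have hj : ∀ F, ∃ a, Θ a = j F := by
    -- The range of an isometry from a complete space is closed, so a dense set of `F` suffices,
    -- namely the span of tensors with compactly supported first factor.
    have hcl : IsClosed {F : C₀(ℝ × B, Matrix (Fin k) (Fin k) 𝕜) |
        ((F.toBCF, 0) : _ × C(X, 𝕜)) ∈ range Θ} :=
      hiso.isClosedEmbedding.isClosed_range.preimage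
        (ZeroAtInftyContinuousMap.isometry_toBCF.continuous.prodMk continuous_const)
    rintro ⟨F, -⟩
    refine closure_minimal (fun F hF => ?_) hcl (mem_closure_compactTensor F)
    induction hF using Submodule.span_induction with
    | zero => exact ⟨0, map_zero Θ⟩
    | add F G _ _ hF hG =>
      obtain ⟨a, ha⟩ := hF
      obtain ⟨b, hb⟩ := hG
      exact ⟨a + b, by rw [map_add, ha, hb]; ext <;> simp⟩
    | smul c F _ hF =>
      obtain ⟨a, ha⟩ := hF
      exact ⟨c • a, by rw [map_smul, ha]; ext <;> simp⟩
    | mem F hF =>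
      obtain ⟨f, g, a, hf, rfl⟩ := hF
      obtain ⟨h, hh⟩ := exists_totalRep_eq hp hS _ (hasCompactSupport_elemTensor hf g a)
      exact ⟨_, (hΘ h).trans hh⟩
  obtain ⟨i, hi⟩ := exists_lift_of_range_subset Θ hiso.injective j hj
  refine ⟨i, (NonUnitalStarAlgHom.snd 𝕜 _ _).comp Θ, ?_, ?_, ?_, ?_⟩
  · intro F G h
    have h1 : j F = j G := by rw [← hi, ← hi, h]
    exact Subtype.ext (ZeroAtInftyContinuousMap.toBCF_injective _ _ (Prod.ext_iff.1 h1).1)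
  · intro a
    change (Θ a).2 = 0 ↔ _
    constructor
    · intro ha
      have h1 : (Θ a).1 ∈ range (ZeroAtInftyContinuousMap.toBCF :
          C₀(ℝ × B, Matrix (Fin k) (Fin k) 𝕜) → _) := by
        -- Approximate `a` by some `f` in `C_c(G)`. As `q a = 0`, the restriction of `f` to `M` has
        -- norm below `ε / 2`, and so has its lift `f'`. Then `f - f'` vanishes on the units in `M`,
        -- and its matrix function is within `ε` of that of `a`.
        refine ZeroAtInftyContinuousMap.isClosed_range_toBCF.closure_subset ?_
        refine Metric.mem_closure_iff.2 fun ε hε => ?_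
        obtain ⟨f, hf⟩ := CStarAlg.denseRange_ι.exists_dist_lt a (half_pos hε)
        rw [← hiso.dist_eq, hΘ, dist_eq_norm] at hf
        obtain ⟨f', hf', hn'⟩ := exists_baseRep_eq hp hS (baseRep f)
        have h2 : ‖baseRep f‖ < ε / 2 := by
          refine lt_of_le_of_lt (le_of_eq ?_) ((norm_snd_le _).trans_lt hf)
          rw [Prod.snd_sub, ha, zero_sub, norm_neg, totalRep_apply]
        refine ⟨_, cylinderRep_mem_range hp hS (f - f') fun x => ?_, ?_⟩
        · rw [← baseRep_apply, map_sub, hf', sub_self]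
          rfl
        · rw [dist_eq_norm]
          have h3 : (Θ a).1 - cylinderRep hp (f - f') =
              (Θ a - totalRep hp f).1 + (totalRep hp f').1 := by
            rw [map_sub, totalRep_apply, totalRep_apply, Prod.fst_sub]
            abel
          rw [h3]
          linarith [norm_add_le (Θ a - totalRep hp f).1 (totalRep hp f').1,
            norm_fst_le (Θ a - totalRep hp f), norm_fst_le (totalRep hp f')]
      obtain ⟨F, hF⟩ := h1
      refine ⟨⟨F, mem_cstarTensor F⟩, hiso.injective ?_⟩
      rw [hi]
      exact Prod.ext hF ha.symm
    · rintro ⟨F, rfl⟩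
      rw [hi]
      rfl
  · intro g
    obtain ⟨f, hf, -⟩ := exists_baseRep_eq hp hS g
    refine ⟨CStarAlg.ι 𝕜 _ f, ?_⟩
    change (Θ _).2 = g
    rw [hΘ, ← hf]
    rfl
  · intro f x
    change (Θ _).2 x = _
    rw [hΘ]
    rfl

end Main

end AttachCylinder

end

theorem mainTheorem7 {𝕜 : Type} [RCLike 𝕜] {k : ℕ} [NeZero k] (hk : 2 ≤ k)
    {E H : Type*} [NormedAddCommGroup E] [NormedSpace ℝ E] [FiniteDimensional ℝ E]
    [TopologicalSpace H] {I : ModelWithCorners ℝ E H} [HalfSpaceModel I]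
    {M : Type*} [TopologicalSpace M] [ChartedSpace H M] [IsManifold I ∞ M]
    [T2Space M] [CompactSpace M]
    {d : ℕ} {B : Type*} [TopologicalSpace B] [ChartedSpace (EuclideanSpace ℝ (Fin d)) B]
    [IsManifold (𝓡 d) ∞ B] [T2Space B] [CompactSpace B]
    (σ : ZkStructure I M d B k) :
    ∃ (i : cstarTensor 𝕜 k B →⋆ₙₐ[𝕜] σ.CStar 𝕜) (q : σ.CStar 𝕜 →⋆ₙₐ[𝕜] C(M, 𝕜)),
      Function.Injective i ∧ Function.Exact i q ∧ Function.Surjective q ∧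
      ∀ (f : EquivRel.ConvAlg 𝕜 σ.rel) (x : M),
        q (EquivRel.CStarAlg.ι 𝕜 σ.rel f) x = f.coef (σ.ofM x) (σ.ofM x) := by
  -- Any bijection of `ZMod k` with `Fin k` serves, both being discrete; it only fixes an order of
  -- the sheets, and the projection to `B` is unchanged.
  let ψ : I.boundary M ≃ₜ B × Fin k := σ.φ.trans ((Homeomorph.refl B).prodCongr
    (Fintype.equivFinOfCardEq (ZMod.card k)).toHomeomorphOfDiscrete)
  have : T2Space (AttachCylinder (I.boundary M)) := inferInstanceAs (T2Space σ.N)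
  have : EquivRel.IsEtale (cylinderSetoid σ.p) := inferInstanceAs (EquivRel.IsEtale σ.rel)
  exact AttachCylinder.exists_exact_sequence (p := σ.p) (ψ := ψ) (fun _ => rfl) σ.isClosed_boundary
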